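/- Let $\Omega\subset\mathbf R^2$ be a bounded open set with smooth boundary containing the origin. Let $H^1_0(\Omega)$ be the closure of $\mathcal C^\infty_c(\Omega)$ in $H^1(\Omega)$ (real-valued functions), equipped with the inner product $\langle u,v\rangle=\int_\Omega\nabla u\cdot\nabla v\,dx$. For an open set $G$ with $\overline G\subset\Omega$, the Poincaré variational operator $T_G:H^1_0(\Omega)\to H^1_0(\Omega)$ is defined as follows: $T_Gu$ is the unique element of $H^1_0(\Omega)$ such that $$\int_\Omega\nabla(T_Gu)\cdot\nabla v\,dx=\int_G\nabla u\cdot\nabla v\,dx\qquad\text{for all }v\in H^1_0(\Omega).$$ Its (real) spectrum $\sigma(T_G)$ is the set of $\lambda\in\mathbf R$ such that $\lambda\,\mathrm{Id}-T_G$ does not have a bounded inverse. Let $D=D_1\cup D_2$ be a bowtie with $\overline D\subset\Omega$: $D_1,D_2$ are connected (nonempty) open sets whose boundaries are smooth except at $0$, and there are $r_0>0$ and $0<\alpha<\pi$ such that, $B_{r_0}$ being the open ball with center $0$ and radius $r_0$, $$D_1\cap B_{r_0}=\{(r\cos\theta,r\sin\theta):0<r<r_0,\ -\tfrac\alpha2<\theta<\tfrac\alpha2\},$$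 $$D_2\cap B_{r_0}=\{(r\cos\theta,r\sin\theta):0<r<r_0,\ \pi-\tfrac\alpha2<\theta<\pi+\tfrac\alpha2\}.$$ For $\delta>0$ small enough that $\overline{D_\delta}\subset\Omega$, let $D_\delta=\big((\delta/2,0)+D_1\big)\cup\big((-\delta/2,0)+D_2\big)$, and define the limit spectrum $$\lim_{\delta\to0}\sigma(T_{D_\delta}):=\{\beta\in\mathbf R:\ \exists\,\delta_n\downarrow0\ (\delta_n>0,\ \overline{D_{\delta_n}}\subset\Omega),\ \exists\,\beta_n\in\sigma(T_{D_{\delta_n}}),\ \beta_n\to\beta\}.$$ Then $$\lim_{\delta\to0}\sigma(T_{D_\delta})=\sigma(T_D)=[0,1].$$ -/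

import Mathlib

open Set Filter Topology MeasureTheory
open scoped ContDiff Gradient ENNReal NNReal

noncomputable section

namespace Bowtie

/-- The Euclidean plane. -/
abbrev Plane : Type := EuclideanSpace ℝ (Fin 2)

/-- Bounded open subsets of the plane (the hold-all domains `Ω`). -/
structure BoundedOpenSet where
  carrier : Set Plane
  isOpen : IsOpen carrier
  isBounded : Bornology.IsBounded carrier

/-- Real-valued square integrable functions on `U`. -/
abbrev L2 (U : Set Plane) : Type := Lp ℝ 2 (volume.restrict U)

/-- Square integrable vector fields on `U`. -/
abbrev L2Field (U : Set Plane) : Type := Lp Plane 2 (volume.restrict U)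

/-- `φ ∈ C_c^∞(U)`. -/
def IsTestFunction (U : Set Plane) (φ : Plane → ℝ) : Prop :=
  ContDiff ℝ ∞ φ ∧ HasCompactSupport φ ∧ tsupport φ ⊆ U

theorem IsTestFunction.zero (U : Set Plane) : IsTestFunction U (fun _ => 0) :=
  ⟨contDiff_const, HasCompactSupport.zero, by
    have : tsupport (fun _ : Plane => (0 : ℝ)) = ∅ := tsupport_eq_empty_iff.2 rfl
    simp [this]⟩

theorem IsTestFunction.add {U : Set Plane} {φ ψ : Plane → ℝ} (hφ : IsTestFunction U φ)
    (hψ : IsTestFunction U ψ) : IsTestFunction U (fun x => φ x + ψ x) :=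
  ⟨hφ.1.add hψ.1, hφ.2.1.add hψ.2.1,
    (tsupport_add φ ψ).trans (union_subset hφ.2.2 hψ.2.2)⟩

theorem IsTestFunction.const_mul {U : Set Plane} {φ : Plane → ℝ} (c : ℝ)
    (hφ : IsTestFunction U φ) : IsTestFunction U (fun x => c * φ x) :=
  ⟨contDiff_const.mul hφ.1, hφ.2.1.mul_left,
    (tsupport_mul_subset_right (f := fun _ => c) (g := φ)).trans hφ.2.2⟩

theorem IsTestFunction.hasGradientAt {U : Set Plane} {φ : Plane → ℝ} (hφ : IsTestFunction U φ)
    (x : Plane) : HasGradientAt φ (∇ φ x) x :=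
  (hφ.1.differentiable (by simp) x).hasGradientAt

/-- The pairs `(φ, ∇φ)`, `φ ∈ C_c^∞(Ω)`, as a subspace of `L²(Ω) × L²(Ω; ℝ²)`. -/
def testPairs (U : Set Plane) : Submodule ℝ (L2 U × L2Field U) where
  carrier := {p | ∃ φ : Plane → ℝ, IsTestFunction U φ ∧
    p.1 =ᵐ[volume.restrict U] φ ∧ p.2 =ᵐ[volume.restrict U] ∇ φ}
  zero_mem' := by
    refine ⟨fun _ => 0, .zero U, Lp.coeFn_zero .., ?_⟩
    filter_upwards [Lp.coeFn_zero Plane 2 (volume.restrict U)] with x hx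
    simp only [Prod.snd_zero, hx]
    simp [gradient]
  add_mem' := by
    rintro p q ⟨φ, hφ, h1, h2⟩ ⟨ψ, hψ, h3, h4⟩
    refine ⟨_, hφ.add hψ, ?_, ?_⟩
    · filter_upwards [Lp.coeFn_add p.1 q.1, h1, h3] with x hx h1 h3
      rw [Prod.fst_add, hx, Pi.add_apply, h1, h3]
    · filter_upwards [Lp.coeFn_add p.2 q.2, h2, h4] with x hx h2 h4
      have : ∇ (fun y => φ y + ψ y) x = ∇ φ x + ∇ ψ x := by
        have a := (hφ.hasGradientAt x).hasFDerivAt.add (hψ.hasGradientAt x).hasFDerivAt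
        rw [← map_add] at a
        exact (hasGradientAt_iff_hasFDerivAt.2 a).gradient
      rw [Prod.snd_add, hx, Pi.add_apply, h2, h4, this]
  smul_mem' := by
    rintro c p ⟨φ, hφ, h1, h2⟩
    refine ⟨_, hφ.const_mul c, ?_, ?_⟩
    · filter_upwards [Lp.coeFn_smul c p.1, h1] with x hx h1
      simp [hx, h1]
    · filter_upwards [Lp.coeFn_smul c p.2, h2] with x hx h2
      have : ∇ (fun y => c * φ y) x = c • ∇ φ x := by
        have a := (hφ.hasGradientAt x).hasFDerivAt.const_mul c
        rw [← map_smul] at a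
        exact (hasGradientAt_iff_hasFDerivAt.2 a).gradient
      simp [hx, h2, this]

/-- The closure of `C_c^∞(U)` for the `H¹(U)` norm; a function `u` is recorded together with its
weak gradient, i.e. as the pair `(u, ∇u)`. -/
def sobolevPairs (U : Set Plane) : Submodule ℝ (L2 U × L2Field U) :=
  (testPairs U).topologicalClosure

/-- `g` is the gradient of `u` on `U` in the sense of distributions. -/
def HasWeakGradient (U : Set Plane) (u : Plane → ℝ) (g : Plane → Plane) : Prop :=
  ∀ φ : Plane → ℝ, IsTestFunction U φ → ∀ v : Plane,
    ∫ x in U, u x * fderiv ℝ φ x v = - ∫ x in U, inner ℝ v (g x) * φ x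

theorem eLpNorm_one_le {F : Type*} [NormedAddCommGroup F] {U : Set Plane} {f : Plane → F} (hf : Continuous f)
    (hs : f.support ⊆ U) :
    eLpNorm f 1 volume ≤ eLpNorm f 2 (volume.restrict U) * (volume U) ^ (1 / 2 : ℝ) := by
  have h := eLpNorm_le_eLpNorm_mul_rpow_measure_univ (μ := volume.restrict U)
    (p := 1) (q := 2) one_le_two hf.aestronglyMeasurable
  have e0 : eLpNorm f 1 (volume.restrict U) = eLpNorm f 1 volume :=
    eLpNorm_restrict_eq_of_support_subset hs
  have e : 1 / (1 : ℝ≥0∞).toReal - 1 / (2 : ℝ≥0∞).toReal = 1 / 2 := by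
    rw [ENNReal.toReal_one, ENNReal.toReal_ofNat]; norm_num
  rwa [e0, Measure.restrict_apply_univ, e] at h

/-- Poincaré's inequality for test functions. -/
theorem poincare_test {U : Set Plane} (hb : Bornology.IsBounded U) :
    ∃ C : ℝ≥0, ∀ φ : Plane → ℝ, IsTestFunction U φ →
      eLpNorm φ 2 (volume.restrict U) ≤ C * eLpNorm (∇ φ) 2 (volume.restrict U) := by
  have hr : (volume U) ^ (1 / 2 : ℝ) ≠ ⊤ :=
    ENNReal.rpow_ne_top_of_nonneg (by norm_num) hb.measure_lt_top.ne
  refine ⟨eLpNormLESNormFDerivOfLeConst ℝ (volume : Measure Plane) U 1 2 *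
    ((volume U) ^ (1 / 2 : ℝ)).toNNReal, fun φ hφ => ?_⟩
  have hs : φ.support ⊆ U := (subset_tsupport φ).trans hφ.2.2
  have hs' : (fderiv ℝ φ).support ⊆ U := (support_fderiv_subset ℝ).trans hφ.2.2
  have key := eLpNorm_le_eLpNorm_fderiv_of_le (volume : Measure Plane) (p := 1) (q := 2)
      (hφ.1.of_le (by simp)) hs le_rfl (by simp) (by simp; norm_num) hb
  have e1 : eLpNorm φ 2 (volume.restrict U) = eLpNorm φ 2 volume :=
    eLpNorm_restrict_eq_of_support_subset hs
  have e2 : eLpNorm (∇ φ) 2 (volume.restrict U) = eLpNorm (fderiv ℝ φ) 2 (volume.restrict U) :=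
    eLpNorm_congr_norm_ae (ae_of_all _ fun x => by simp [gradient])
  have k2 := eLpNorm_one_le (hφ.1.continuous_fderiv (by simp)) hs'
  rw [e1, e2, ENNReal.coe_mul, ENNReal.coe_toNNReal hr, mul_assoc, mul_comm (_ ^ _)]
  exact key.trans (mul_le_mul_right k2 _)

theorem poincare_testPairs (Ω : BoundedOpenSet) :
    ∃ C : ℝ≥0, ∀ p ∈ testPairs Ω.carrier, ‖p.1‖ ≤ C * ‖p.2‖ := by
  obtain ⟨C, hC⟩ := poincare_test Ω.isBounded
  refine ⟨C, ?_⟩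
  rintro p ⟨φ, hφ, h1, h2⟩
  have k := hC φ hφ
  rw [← eLpNorm_congr_ae h1, ← eLpNorm_congr_ae h2] at k
  have k4 := ENNReal.toReal_mono (ENNReal.mul_ne_top ENNReal.coe_ne_top
    (Lp.eLpNorm_ne_top p.2)) k
  rwa [ENNReal.toReal_mul, ENNReal.coe_toReal, ← Lp.norm_def, ← Lp.norm_def] at k4

/-- Poincaré's inequality on `H¹₀(Ω)`. -/
theorem poincare_sobolevPairs (Ω : BoundedOpenSet) :
    ∃ C : ℝ≥0, ∀ p ∈ sobolevPairs Ω.carrier, ‖p.1‖ ≤ C * ‖p.2‖ := by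
  obtain ⟨C, hC⟩ := poincare_testPairs Ω
  refine ⟨C, fun p hp => ?_⟩
  have hcl : IsClosed {p : L2 Ω.carrier × L2Field Ω.carrier | ‖p.1‖ ≤ C * ‖p.2‖} :=
    isClosed_le (by fun_prop) (by fun_prop)
  exact closure_minimal (fun q hq => hC q hq) hcl hp

/-- In a pair `(u, g)` of `sobolevPairs U`, the field `g` is the weak gradient of `u`. -/
theorem hasWeakGradient_of_mem {U : Set Plane} {p : L2 U × L2Field U} (hp : p ∈ sobolevPairs U) :
    HasWeakGradient U p.1 p.2 := by
  intro φ hφ v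
  have hdc : HasCompactSupport (fun x => fderiv ℝ φ x v) := hφ.2.1.fderiv_apply ℝ v
  have hcd : Continuous (fun x => fderiv ℝ φ x v) :=
    (hφ.1.continuous_fderiv (by simp)).clm_apply continuous_const
  have m1 : MemLp (fun x => fderiv ℝ φ x v) 2 (volume.restrict U) :=
    (hcd.memLp_of_hasCompactSupport hdc).restrict U
  have m2 : MemLp (fun x => φ x • v) 2 (volume.restrict U) :=
    ((hφ.1.continuous.smul continuous_const).memLp_of_hasCompactSupport
      (hφ.2.1.smul_right (f' := fun _ => v))).restrict U
  have i1 : ∀ q : L2 U × L2Field U,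
      inner ℝ (m1.toLp _) q.1 = ∫ x in U, q.1 x * fderiv ℝ φ x v := fun q => by
    rw [L2.inner_def]
    refine integral_congr_ae ?_
    filter_upwards [m1.coeFn_toLp] with x hx
    simp [hx]
  have i2 : ∀ q : L2 U × L2Field U,
      inner ℝ (m2.toLp _) q.2 = ∫ x in U, inner ℝ v (q.2 x) * φ x := fun q => by
    rw [L2.inner_def]
    refine integral_congr_ae ?_
    filter_upwards [m2.coeFn_toLp] with x hx
    rw [hx, real_inner_smul_left, mul_comm]
  have hcl : IsClosed {q : L2 U × L2Field U |
      inner ℝ (m1.toLp _) q.1 = - inner ℝ (m2.toLp _) q.2} :=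
    isClosed_eq (by fun_prop) (by fun_prop)
  have : inner ℝ (m1.toLp _) p.1 = - inner ℝ (m2.toLp _) p.2 := by
    refine closure_minimal ?_ hcl hp
    rintro q ⟨ψ, hψ, h1, h2⟩
    rw [mem_ofPred_eq, i1, i2]
    have hcd' : Continuous (fun x => fderiv ℝ ψ x v) :=
      (hψ.1.continuous_fderiv (by simp)).clm_apply continuous_const
    have a1 : ∫ x in U, q.1 x * fderiv ℝ φ x v = ∫ x, ψ x * fderiv ℝ φ x v := by
      rw [integral_congr_ae (g := fun x => ψ x * fderiv ℝ φ x v)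
        (by filter_upwards [h1] with x hx; rw [hx])]
      refine setIntegral_eq_integral_of_forall_compl_eq_zero fun x hx => ?_
      rw [image_eq_zero_of_notMem_tsupport (fun h => hx (hψ.2.2 h)), zero_mul]
    have a2 : ∫ x in U, inner ℝ v (q.2 x) * φ x = ∫ x, fderiv ℝ ψ x v * φ x := by
      rw [integral_congr_ae (g := fun x => fderiv ℝ ψ x v * φ x)
        (by filter_upwards [h2] with x hx; rw [hx, inner_gradient_right]; simp)]
      refine setIntegral_eq_integral_of_forall_compl_eq_zero fun x hx => ?_
      rw [image_eq_zero_of_notMem_tsupport (f := φ) (fun h => hx (hφ.2.2 h)), mul_zero]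
    rw [a1, a2]
    exact integral_mul_fderiv_eq_neg_fderiv_mul_of_integrable
      ((hcd'.mul hφ.1.continuous).integrable_of_hasCompactSupport hφ.2.1.mul_left)
      ((hψ.1.continuous.mul hcd).integrable_of_hasCompactSupport hdc.mul_left)
      ((hψ.1.continuous.mul hφ.1.continuous).integrable_of_hasCompactSupport hφ.2.1.mul_left)
      (fun x _ => hψ.1.differentiable (by simp) x) (fun x _ => hφ.1.differentiable (by simp) x)
  rw [← i1, ← i2, this]

/-- The energy space `H¹₀(Ω)`. It carries the Dirichlet inner product, see below. -/
def H10 (Ω : BoundedOpenSet) : Type := sobolevPairs Ω.carrier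

namespace H10

variable (Ω : BoundedOpenSet)

instance : AddCommGroup (H10 Ω) := inferInstanceAs (AddCommGroup (sobolevPairs Ω.carrier))

instance : Module ℝ (H10 Ω) := inferInstanceAs (Module ℝ (sobolevPairs Ω.carrier))

/-- The underlying square integrable function of an element of `H¹₀(Ω)`. -/
def toFun : H10 Ω →ₗ[ℝ] L2 Ω.carrier :=
  LinearMap.fst ℝ _ _ ∘ₗ (sobolevPairs Ω.carrier).subtype

/-- The weak gradient of an element of `H¹₀(Ω)`. -/
def grad : H10 Ω →ₗ[ℝ] L2Field Ω.carrier :=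
  LinearMap.snd ℝ _ _ ∘ₗ (sobolevPairs Ω.carrier).subtype

theorem grad_injective : Function.Injective (grad Ω) := by
  refine (injective_iff_map_eq_zero _).2 fun u hu => ?_
  obtain ⟨C, hC⟩ := poincare_sobolevPairs Ω
  have h2 : u.1.2 = 0 := hu
  have h1 := hC u.1 u.2
  rw [h2, norm_zero, mul_zero, norm_le_zero_iff] at h1
  exact Subtype.ext (Prod.ext h1 h2)

/-- An element of `H¹₀(Ω)` is determined by its underlying function. -/
theorem toFun_injective : Function.Injective (toFun Ω) := by
  refine (injective_iff_map_eq_zero _).2 fun u hu => ?_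
  have h1 : u.1.1 = 0 := hu
  refine grad_injective Ω ?_
  rw [map_zero]
  have hw := hasWeakGradient_of_mem u.2
  have hi : IntegrableOn u.1.2 Ω.carrier volume := by
    have : IsFiniteMeasure (volume.restrict Ω.carrier) :=
      ⟨by simpa using Ω.isBounded.measure_lt_top⟩
    exact (Lp.memLp u.1.2).integrable (by norm_num)
  have key := Ω.isOpen.ae_eq_zero_of_integral_contDiff_smul_eq_zero
    (μ := (volume : Measure Plane)) (f := u.1.2) hi.locallyIntegrableOn (by
      intro φ h1' h2' h3'
      have hφ : IsTestFunction Ω.carrier φ := ⟨h1', h2', h3'⟩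
      rw [← setIntegral_eq_integral_of_forall_compl_eq_zero (s := Ω.carrier) (fun x hx => by
        rw [image_eq_zero_of_notMem_tsupport (fun h => hx (h3' h)), zero_smul])]
      obtain ⟨M, hM⟩ := h2'.exists_bound_of_continuous h1'.continuous
      have hint : Integrable (fun x => φ x • u.1.2 x) (volume.restrict Ω.carrier) :=
        hi.bdd_smul M h1'.continuous.aestronglyMeasurable (ae_of_all _ hM)
      refine ext_inner_left ℝ fun v => ?_
      rw [inner_zero_right, ← integral_inner hint]
      have a := hw φ hφ v
      have z : ∫ x in Ω.carrier, u.1.1 x * fderiv ℝ φ x v = 0 := by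
        rw [h1]
        refine integral_eq_zero_of_ae ?_
        filter_upwards [Lp.coeFn_zero ℝ 2 (volume.restrict Ω.carrier)] with x hx
        rw [hx, Pi.zero_apply, zero_mul]
      rw [z, eq_comm, neg_eq_zero] at a
      rw [← a]
      refine integral_congr_ae (ae_of_all _ fun x => ?_)
      simp only [real_inner_smul_right, mul_comm])
  refine Lp.ext ?_
  filter_upwards [Lp.coeFn_zero Plane 2 (volume.restrict Ω.carrier),
    (ae_restrict_iff' Ω.isOpen.measurableSet).2 key] with x hx hx'
  rw [hx]
  exact hx'

/-- The norm `‖u‖ = (∫_Ω |∇u|²)^(1/2)`. -/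
instance : NormedAddCommGroup (H10 Ω) :=
  NormedAddCommGroup.induced (H10 Ω) (L2Field Ω.carrier) (grad Ω) (grad_injective Ω)

/-- The inner product `⟪u, v⟫ = ∫_Ω ∇u · ∇v`. -/
instance : InnerProductSpace ℝ (H10 Ω) := InnerProductSpace.induced (grad Ω)

variable {Ω}

theorem inner_eq (u v : H10 Ω) :
    inner ℝ u v = ∫ x in Ω.carrier, inner ℝ (grad Ω u x) (grad Ω v x) := rfl

theorem norm_grad (u : H10 Ω) : ‖grad Ω u‖ = ‖u‖ := rfl

/-- The gradient as an isometric embedding. -/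
def gradₗᵢ : H10 Ω →ₗᵢ[ℝ] L2Field Ω.carrier := ⟨grad Ω, norm_grad⟩

instance : CompleteSpace (H10 Ω) := by
  obtain ⟨C, hC⟩ := poincare_sobolevPairs Ω
  let f : sobolevPairs Ω.carrier →L[ℝ] L2Field Ω.carrier :=
    ContinuousLinearMap.snd ℝ _ _ ∘L (sobolevPairs Ω.carrier).subtypeL
  have : CompleteSpace (sobolevPairs Ω.carrier) :=
    (testPairs Ω.carrier).isClosed_topologicalClosure.completeSpace_coe
  have hanti : AntilipschitzWith (max C 1) f := by
    refine f.antilipschitz_of_bound fun u => ?_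
    have h1 : ‖u.1.1‖ ≤ C * ‖u.1.2‖ := hC u.1 u.2
    change max ‖u.1.1‖ ‖u.1.2‖ ≤ _ * ‖u.1.2‖
    refine max_le (h1.trans ?_) ?_
    · gcongr; exact le_max_left _ _
    · refine le_mul_of_one_le_left (norm_nonneg _) ?_
      exact_mod_cast le_max_right C 1
  have hcl : IsClosed (range f) := hanti.isClosed_range f.uniformContinuous
  have hcl' : IsComplete (range (gradₗᵢ (Ω := Ω))) := hcl.isComplete
  exact (gradₗᵢ (Ω := Ω)).isometry.isUniformInducing.completeSpace hcl'

end H10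

/-- The map `u ↦ ∇u|_D`, `H¹₀(Ω) → L²(Ω ∩ D; ℝ²)`. -/
def gradOn (Ω : BoundedOpenSet) (D : Set Plane) :
    H10 Ω →L[ℝ] Lp Plane 2 ((volume.restrict Ω.carrier).restrict D) :=
  LpToLpRestrictCLM Plane Plane ℝ (volume.restrict Ω.carrier) 2 D ∘L
    H10.gradₗᵢ.toContinuousLinearMap

/-- The Poincaré variational operator `T_D : H¹₀(Ω) → H¹₀(Ω)`, i.e. the operator representing the
form `∫_D ∇u · ∇v` in the Dirichlet inner product; see `poincareOp_spec` and `poincareOp_unique`. -/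
def poincareOp (Ω : BoundedOpenSet) (D : Set Plane) : H10 Ω →L[ℝ] H10 Ω :=
  ContinuousLinearMap.adjoint (gradOn Ω D) ∘L gradOn Ω D

theorem poincareOp_spec (Ω : BoundedOpenSet) {D : Set Plane} (hD : MeasurableSet D)
    (hDΩ : D ⊆ Ω.carrier) (u v : H10 Ω) :
    ∫ x in Ω.carrier, inner ℝ (H10.grad Ω (poincareOp Ω D u) x) (H10.grad Ω v x) =
      ∫ x in D, inner ℝ (H10.grad Ω u x) (H10.grad Ω v x) := by
  have hμ : (volume.restrict Ω.carrier).restrict D = volume.restrict D := by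
    rw [Measure.restrict_restrict hD, inter_eq_left.2 hDΩ]
  rw [← H10.inner_eq, poincareOp, ContinuousLinearMap.comp_apply,
    ContinuousLinearMap.adjoint_inner_left, L2.inner_def]
  conv_rhs => rw [← hμ]
  refine integral_congr_ae ?_
  have h := fun w : H10 Ω => LpToLpRestrictCLM_coeFn (μ := volume.restrict Ω.carrier) ℝ D
    (H10.grad Ω w)
  filter_upwards [h u, h v] with x hu hv
  change inner ℝ (LpToLpRestrictCLM Plane Plane ℝ _ 2 _ (H10.grad Ω u) x)
    (LpToLpRestrictCLM Plane Plane ℝ _ 2 _ (H10.grad Ω v) x) = _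
  rw [hu, hv]

theorem poincareOp_unique (Ω : BoundedOpenSet) {D : Set Plane} (hD : MeasurableSet D)
    (hDΩ : D ⊆ Ω.carrier) (u w : H10 Ω)
    (hw : ∀ v : H10 Ω, ∫ x in Ω.carrier, inner ℝ (H10.grad Ω w x) (H10.grad Ω v x) =
      ∫ x in D, inner ℝ (H10.grad Ω u x) (H10.grad Ω v x)) :
    w = poincareOp Ω D u := by
  refine ext_inner_right ℝ fun v => ?_
  rw [H10.inner_eq, H10.inner_eq, hw, poincareOp_spec Ω hD hDΩ]

/-- Near `p`, the set `U` is the sublevel set of a smooth function with nonvanishing differential: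
the boundary of `U` is smooth at `p`, with `U` on one side of it. -/
def SmoothBoundaryAt (U : Set Plane) (p : Plane) : Prop :=
  ∃ (V : Set Plane) (ρ : Plane → ℝ), IsOpen V ∧ p ∈ V ∧ ContDiffOn ℝ ∞ ρ V ∧
    (∀ x ∈ V, fderiv ℝ ρ x ≠ 0) ∧ U ∩ V = {x ∈ V | ρ x < 0}

/-- The open circular sector with vertex `0`, radius `r₀`, opening `α` and axis of direction
`(cos θ₀, sin θ₀)`. -/
def sector (r₀ α θ₀ : ℝ) : Set Plane :=
  {x | ∃ r θ : ℝ, 0 < r ∧ r < r₀ ∧ θ₀ - α / 2 < θ ∧ θ < θ₀ + α / 2 ∧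
    x = !₂[r * Real.cos θ, r * Real.sin θ]}

/-- `D₁ ∪ D₂` is a bowtie with wings `D₁`, `D₂` (two connected open sets with boundary smooth
except at `0`) which near `0` are the two opposite sectors of opening `α` around the
horizontal axis. -/
structure IsBowtie (r₀ α : ℝ) (D₁ D₂ : Set Plane) : Prop where
  r₀_pos : 0 < r₀
  α_pos : 0 < α
  α_lt : α < Real.pi
  isOpen₁ : IsOpen D₁
  isOpen₂ : IsOpen D₂
  isConnected₁ : IsConnected D₁
  isConnected₂ : IsConnected D₂
  smooth₁ : ∀ p ∈ frontier D₁, p ≠ 0 → SmoothBoundaryAt D₁ p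
  smooth₂ : ∀ p ∈ frontier D₂, p ≠ 0 → SmoothBoundaryAt D₂ p
  sector₁ : D₁ ∩ Metric.ball 0 r₀ = sector r₀ α 0
  sector₂ : D₂ ∩ Metric.ball 0 r₀ = sector r₀ α Real.pi

/-- The bowtie with close-to-touching wings, `D_δ = ((δ/2, 0) + D₁) ∪ ((-δ/2, 0) + D₂)`. -/
def separated (D₁ D₂ : Set Plane) (δ : ℝ) : Set Plane :=
  (fun x => !₂[δ / 2, 0] + x) '' D₁ ∪ (fun x => !₂[-δ / 2, 0] + x) '' D₂

/-- The limit spectrum `lim_{δ → 0} σ(T_{D_δ})`: the limits of sequences `β_n ∈ σ(T_{D_{δ_n}})`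
with `δ_n ↓ 0`, where the `δ_n > 0` are so small that `D_{δ_n} ⋐ Ω`. -/
def limitSpectrum (Ω : BoundedOpenSet) (D₁ D₂ : Set Plane) : Set ℝ :=
  {β | ∃ (δ : ℕ → ℝ) (b : ℕ → ℝ),
    (∀ n, 0 < δ n ∧ closure (separated D₁ D₂ (δ n)) ⊆ Ω.carrier) ∧
    Antitone δ ∧ Tendsto δ atTop (𝓝 0) ∧
    (∀ n, b n ∈ spectrum ℝ (poincareOp Ω (separated D₁ D₂ (δ n)))) ∧
    Tendsto b atTop (𝓝 β)}

end Bowtie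

end

/-!
For an open set `D` the operator `T_D` is the compression of multiplication by `1_D` to the gradient
fields. Hence it is symmetric with spectrum in `[0, 1]`, and the residual of an approximate
eigenvector is `‖T_D u - β u‖ ≤ ‖(1_D - β) ∇u - F‖` for every divergence-free field `F`. In the plane
the fields `F = rot ∇ψ` with `ψ ∈ H¹₀(Ω)` are divergence free (`inner_rot_grad_eq_zero`,
`norm_poincareOp_sub_sq_le`), so a spectral value is found by solving `(1_D - β) ∇u = rot ∇ψ`
approximately.

Near the vertex the bowtie is a double sector, which is invariant under dilations. With `t = log r`
and `a = α / 2`, `γ = π / 2 - a`, separation of variables gives the exact solution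
`u = cos (η t) φ(θ)`, `ψ = η⁻¹ sin (η t) (1_D - β) φ'(θ)`, where `φ'' = η² φ` in each sector and where
`φ` and the flux `(1_D - β) φ'` are continuous. For `φ` proportional to a hyperbolic cosine in the
wings and to a hyperbolic sine in between, the transmission conditions amount to
`(1 - β) tanh (η a) tanh (η γ) = β`, and every `β ∈ (0, 1/2)` occurs (`exists_dispersion`). As
`(1_D - (1 - β)) (1_D - β) = β (1 - β)`, the same pair with the roles of `u` and `ψ` exchanged solves
the equation for `1 - β`.

These solutions have infinite energy at the vertex. Cutting them off by a function of `t` supported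
in an interval of length about `L` gives functions in `H¹₀(Ω)` whose energy grows linearly in `L`,
while the mismatch of the fields only involves the derivative of the cutoff and stays bounded
(`mem_spectrum_of_annular`). So `β` and `1 - β` lie in the spectrum, and `σ(T_D) = [0, 1]` because the
spectrum is closed (`spectrum_bowtie`). The truncated solutions are only Lipschitz; that Lipschitz
functions with compact support belong to `H¹₀(Ω)` is shown by mollification (`exists_grad_ae_eq`).

For the limit spectrum, `D_δ → D` in measure by continuity of translations, hence `T_{D_δ} → T_D`
strongly, and strong convergence of symmetric operators makes every point of `σ(T_D)` a limit of
points of `σ(T_{D_δ})` (`spectrum_subset_limitSpectrum`). The converse inclusion is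
`σ(T_{D_δ}) ⊆ [0, 1] = σ(T_D)`.
-/

noncomputable section

namespace Bowtie

/-! ### Spectra of symmetric operators on a real Hilbert space -/

section Spectrum

variable {H : Type*} [NormedAddCommGroup H] [InnerProductSpace ℝ H]

theorem exists_norm_lower_bound_of_isUnit {S : H →L[ℝ] H} (h : IsUnit S) :
    ∃ c : ℝ, 0 < c ∧ ∀ u, c * ‖u‖ ≤ ‖S u‖ := by
  obtain ⟨R, hR⟩ := h.exists_left_inv
  refine ⟨1 / (‖R‖ + 1), by positivity, fun u => ?_⟩
  have e : R (S u) = u := by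
    rw [← mul_apply_eq_comp, hR, one_apply_eq_self]
  have h1 := R.le_opNorm (S u)
  rw [e] at h1
  rw [div_mul_eq_mul_div, one_mul, div_le_iff₀ (by positivity)]
  nlinarith [norm_nonneg (S u)]

/-- A positive operator satisfies `‖Q u‖² ≤ M ⟪Q u, u⟫` for `M ≥ ‖Q‖`. -/
theorem norm_sq_le_mul_inner {Q : H →L[ℝ] H} (hQ : ∀ u v, inner ℝ (Q u) v = inner ℝ u (Q v))
    (hpos : ∀ u, 0 ≤ inner ℝ (Q u) u) {M : ℝ} (hM : 0 < M) (hQM : ‖Q‖ ≤ M) (u : H) :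
    ‖Q u‖ ^ 2 ≤ M * inner ℝ (Q u) u := by
  -- the choice `M⁻¹` nearly minimizes the quadratic form along `u - s • Q u`
  have h1 := hpos (u - M⁻¹ • Q u)
  have h2 : inner ℝ (Q (Q u)) (Q u) ≤ M * ‖Q u‖ ^ 2 := by
    refine (real_inner_le_norm _ _).trans ?_
    have := (Q.le_opNorm (Q u)).trans (mul_le_mul_of_nonneg_right hQM (norm_nonneg _))
    nlinarith [norm_nonneg (Q u)]
  have h3 : inner ℝ (Q (Q u)) u = ‖Q u‖ ^ 2 := by rw [hQ, real_inner_self_eq_norm_sq]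
  simp only [map_sub, map_smul, inner_sub_left, inner_sub_right, real_inner_smul_left,
    real_inner_smul_right, h3, real_inner_self_eq_norm_sq] at h1
  have h4 : M⁻¹ * (M⁻¹ * inner ℝ (Q (Q u)) (Q u)) ≤ M⁻¹ * ‖Q u‖ ^ 2 := by
    have : M⁻¹ * inner ℝ (Q (Q u)) (Q u) ≤ ‖Q u‖ ^ 2 := by
      rw [inv_mul_le_iff₀ hM]; exact h2
    gcongr
  have h5 : M⁻¹ * ‖Q u‖ ^ 2 ≤ inner ℝ (Q u) u := by linarith
  rwa [inv_mul_le_iff₀ hM] at h5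

/-- An approximate eigenvalue is a spectral value. -/
theorem mem_spectrum_of_approx {T : H →L[ℝ] H} {β : ℝ}
    (h : ∀ ε > 0, ∃ u, ‖T u - β • u‖ < ε * ‖u‖) : β ∈ spectrum ℝ T := by
  intro hu
  obtain ⟨c, hc, hb⟩ := exists_norm_lower_bound_of_isUnit hu
  obtain ⟨u, h1⟩ := h c hc
  have h2 := hb u
  rw [sub_apply, Algebra.algebraMap_eq_smul_one, smul_apply,
    one_apply_eq_self, norm_sub_rev] at h2
  linarith

/-- An approximate eigenvalue of a symmetric operator with residual `ε` is at distance at most `ε`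
from the spectrum. If not, the infimum `m` of `‖(T - β) u‖² / ‖u‖²` is `μ²` with `β ± μ` in the
resolvent set, although `(T - β)² - m` is positive and not bounded below. -/
theorem exists_mem_spectrum_near {T : H →L[ℝ] H}
    (hT : ∀ u v, inner ℝ (T u) v = inner ℝ u (T v)) {β ε : ℝ} {u₀ : H}
    (hu₀ : ‖T u₀ - β • u₀‖ < ε * ‖u₀‖) : ∃ b ∈ spectrum ℝ T, |b - β| < ε := by
  by_contra! hcon
  have hu0 : 0 < ‖u₀‖ := by
    rcases (norm_nonneg u₀).eq_or_lt with h | h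
    · rw [← h, mul_zero] at hu₀
      exact absurd hu₀ (not_lt.2 (norm_nonneg _))
    · exact h
  have hε : 0 < ε := by
    by_contra! h
    nlinarith [norm_nonneg (T u₀ - β • u₀)]
  set S : H →L[ℝ] H := T - β • 1 with hS
  have hSa : ∀ u, S u = T u - β • u := fun u => rfl
  have hSs : ∀ u v, inner ℝ (S u) v = inner ℝ u (S v) := fun u v => by
    simp only [hSa, inner_sub_left, inner_sub_right, hT, real_inner_smul_left,
      real_inner_smul_right]
  -- `m = μ ^ 2` is the bottom of the spectrum of `S ^ 2`
  set K : Set ℝ := {t | ∃ u : H, u ≠ 0 ∧ t = ‖S u‖ ^ 2 / ‖u‖ ^ 2}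
  have hK0 : ∀ t ∈ K, 0 ≤ t := by rintro t ⟨u, -, rfl⟩; positivity
  have hKb : BddBelow K := ⟨0, hK0⟩
  have hu₀K : ‖S u₀‖ ^ 2 / ‖u₀‖ ^ 2 ∈ K := ⟨u₀, norm_pos_iff.1 hu0, rfl⟩
  set m := sInf K
  have hm0 : 0 ≤ m := le_csInf ⟨_, hu₀K⟩ hK0
  have hmε : m < ε ^ 2 := by
    refine (csInf_le hKb hu₀K).trans_lt ?_
    rw [div_lt_iff₀ (by positivity), ← mul_pow]
    exact pow_lt_pow_left₀ hu₀ (norm_nonneg _) two_ne_zero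
  set μ := √m
  have hμ : μ ^ 2 = m := Real.sq_sqrt hm0
  have hμ0 : 0 ≤ μ := Real.sqrt_nonneg _
  have hμε : μ < ε := lt_of_pow_lt_pow_left₀ 2 hε.le (by rw [hμ]; exact hmε)
  have hunit : ∀ t : ℝ, |t| < ε → IsUnit (S - t • 1) := fun t ht => by
    have h1 : β + t ∉ spectrum ℝ T := fun h => by
      have := hcon _ h
      rw [add_sub_cancel_left] at this
      linarith
    have h2 := (spectrum.notMem_iff.1 h1).neg
    convert h2 using 1
    rw [hS, Algebra.algebraMap_eq_smul_one, add_smul]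
    abel
  set Q : H →L[ℝ] H := (S - μ • 1) * (S - (-μ) • 1) with hQ
  have hQu : IsUnit Q := (hunit μ (by rwa [abs_of_nonneg hμ0])).mul
    (hunit (-μ) (by rwa [abs_neg, abs_of_nonneg hμ0]))
  have hQa : ∀ u, Q u = S (S u) - m • u := fun u => by
    have e : ∀ (t : ℝ) (w : H), (S - t • 1) w = S w - t • w := fun t w => rfl
    rw [hQ, mul_apply_eq_comp, e, e, map_sub, map_smul, ← hμ]
    module
  have hQs : ∀ u v, inner ℝ (Q u) v = inner ℝ u (Q v) := fun u v => by
    simp only [hQa, inner_sub_left, inner_sub_right, hSs, real_inner_smul_left,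
      real_inner_smul_right]
  have hQi : ∀ u, inner ℝ (Q u) u = ‖S u‖ ^ 2 - m * ‖u‖ ^ 2 := fun u => by
    rw [hQa, inner_sub_left, hSs, real_inner_smul_left, real_inner_self_eq_norm_sq,
      real_inner_self_eq_norm_sq]
  have hQp : ∀ u, 0 ≤ inner ℝ (Q u) u := fun u => by
    rw [hQi]
    by_cases hu : u = 0
    · simp [hu]
    · have hu' : 0 < ‖u‖ := norm_pos_iff.2 hu
      have := csInf_le hKb ⟨u, hu, rfl⟩
      rw [le_div_iff₀ (by positivity)] at this
      linarith
  obtain ⟨c, hc, hcb⟩ := exists_norm_lower_bound_of_isUnit hQu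
  have hM : 0 < ‖Q‖ + 1 := by positivity
  obtain ⟨t, ⟨u, hu, rfl⟩, ht⟩ := exists_lt_of_csInf_lt ⟨_, hu₀K⟩
    (show m < m + c ^ 2 / (‖Q‖ + 1) by linarith [show 0 < c ^ 2 / (‖Q‖ + 1) by positivity])
  have hu' : 0 < ‖u‖ := norm_pos_iff.2 hu
  have h1 := norm_sq_le_mul_inner hQs hQp hM (by linarith) u
  have h2 := pow_le_pow_left₀ (by positivity) (hcb u) 2
  rw [div_lt_iff₀ (by positivity)] at ht
  rw [hQi] at h1
  have h3 : (‖Q‖ + 1) * (‖S u‖ ^ 2 - m * ‖u‖ ^ 2) < c ^ 2 * ‖u‖ ^ 2 := by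
    rw [← lt_div_iff₀' hM]
    have e : c ^ 2 * ‖u‖ ^ 2 / (‖Q‖ + 1) = c ^ 2 / (‖Q‖ + 1) * ‖u‖ ^ 2 := by ring
    rw [e]
    linarith
  rw [mul_pow] at h2
  linarith

variable [CompleteSpace H]

theorem isUnit_of_norm_lower_bound {S : H →L[ℝ] H} (hS : ∀ u v, inner ℝ (S u) v = inner ℝ u (S v))
    {c : ℝ} (hc : 0 < c) (h : ∀ u, c * ‖u‖ ≤ ‖S u‖) : IsUnit S := by
  have h2 : IsUnit (S * S) := by
    refine ContinuousLinearMap.isUnit_of_forall_le_norm_inner_map (S * S) (c := ⟨c ^ 2, by positivity⟩)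
      (by exact_mod_cast (pow_pos hc 2)) fun u => ?_
    have e : inner ℝ ((S * S) u) u = ‖S u‖ ^ 2 := by
      rw [mul_apply_eq_comp, hS, real_inner_self_eq_norm_sq]
    rw [e, Real.norm_of_nonneg (by positivity)]
    have := pow_le_pow_left₀ (by positivity) (h u) 2
    rw [mul_pow] at this
    change ‖u‖ ^ 2 * c ^ 2 ≤ _
    linarith
  exact ((Commute.refl S).isUnit_mul_iff.1 h2).1

/-- The spectrum of a symmetric operator consists of approximate eigenvalues. -/
theorem exists_approx_of_mem_spectrum {T : H →L[ℝ] H}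
    (hT : ∀ u v, inner ℝ (T u) v = inner ℝ u (T v)) {β : ℝ} (hβ : β ∈ spectrum ℝ T)
    {ε : ℝ} (hε : 0 < ε) : ∃ u, ‖T u - β • u‖ < ε * ‖u‖ := by
  by_contra! hcon
  refine hβ (isUnit_of_norm_lower_bound (fun u v => ?_) hε fun u => ?_)
  · simp [Algebra.algebraMap_eq_smul_one, inner_sub_left, inner_sub_right, hT,
      real_inner_smul_left, real_inner_smul_right]
  · have := hcon u
    rwa [sub_apply, Algebra.algebraMap_eq_smul_one,
      smul_apply, one_apply_eq_self, norm_sub_rev]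

theorem isClosed_spectrum (T : H →L[ℝ] H) : IsClosed (spectrum ℝ T) :=
  spectrum.isClosed T

theorem spectrum_subset_Icc {T : H →L[ℝ] H} (h0 : ∀ u, 0 ≤ inner ℝ (T u) u)
    (h1 : ∀ u, inner ℝ (T u) u ≤ ‖u‖ ^ 2) : spectrum ℝ T ⊆ Icc 0 1 := by
  intro β hβ
  by_contra hcon
  refine hβ ?_
  have e : ∀ u, inner ℝ ((algebraMap ℝ (H →L[ℝ] H) β - T) u) u =
      β * ‖u‖ ^ 2 - inner ℝ (T u) u := fun u => by
    rw [sub_apply, Algebra.algebraMap_eq_smul_one,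
      smul_apply, one_apply_eq_self, inner_sub_left,
      real_inner_smul_left, real_inner_self_eq_norm_sq]
  rcases lt_or_ge β 0 with hb | hb
  · refine ContinuousLinearMap.isUnit_of_forall_le_norm_inner_map _ (c := ⟨-β, by linarith⟩)
      (by exact_mod_cast (neg_pos.2 hb)) fun u => ?_
    rw [e]
    refine le_trans ?_ (neg_le_abs _)
    change ‖u‖ ^ 2 * -β ≤ _
    linarith [h0 u]
  · have hb' : 1 < β := by
      by_contra! h
      exact hcon ⟨hb, h⟩
    refine ContinuousLinearMap.isUnit_of_forall_le_norm_inner_map _ (c := ⟨β - 1, by linarith⟩)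
      (by exact_mod_cast (sub_pos.2 hb')) fun u => ?_
    rw [e]
    refine le_trans ?_ (le_abs_self _)
    change ‖u‖ ^ 2 * (β - 1) ≤ _
    linarith [h1 u]

end Spectrum

/-! ### The variational operator and divergence-free fields -/

theorem inner_poincareOp (Ω : BoundedOpenSet) (D : Set Plane) (u v : H10 Ω) :
    inner ℝ (poincareOp Ω D u) v = inner ℝ (gradOn Ω D u) (gradOn Ω D v) := by
  rw [poincareOp, ContinuousLinearMap.comp_apply, ContinuousLinearMap.adjoint_inner_left]

theorem poincareOp_symm (Ω : BoundedOpenSet) (D : Set Plane) (u v : H10 Ω) :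
    inner ℝ (poincareOp Ω D u) v = inner ℝ u (poincareOp Ω D v) := by
  rw [inner_poincareOp, real_inner_comm, ← inner_poincareOp, real_inner_comm]

theorem spectrum_poincareOp_subset (Ω : BoundedOpenSet) (D : Set Plane) :
    spectrum ℝ (poincareOp Ω D) ⊆ Icc 0 1 := by
  refine spectrum_subset_Icc (fun u => ?_) fun u => ?_
  · rw [inner_poincareOp]
    exact real_inner_self_nonneg
  · rw [inner_poincareOp, real_inner_self_eq_norm_sq]
    refine pow_le_pow_left₀ (norm_nonneg _) ?_ 2
    exact (norm_Lp_toLp_restrict_le D (H10.grad Ω u)).trans_eq (H10.norm_grad u)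

/-- The rotation of the plane by a right angle. -/
def rot : Plane →L[ℝ] Plane :=
  LinearMap.toContinuousLinearMap
    { toFun := fun x => !₂[-x 1, x 0]
      map_add' := fun x y => by ext i; fin_cases i <;> simp [add_comm]
      map_smul' := fun c x => by ext i; fin_cases i <;> simp }

@[simp] theorem rot_zero_apply (x : Plane) : rot x 0 = -x 1 := rfl

@[simp] theorem rot_one_apply (x : Plane) : rot x 1 = x 0 := rfl

theorem plane_inner (x y : Plane) : inner ℝ x y = x 0 * y 0 + x 1 * y 1 := by
  rw [EuclideanSpace.inner_eq_star_dotProduct]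
  simp [dotProduct, Fin.sum_univ_two, mul_comm]

theorem plane_norm_sq (x : Plane) : ‖x‖ ^ 2 = x 0 ^ 2 + x 1 ^ 2 := by
  rw [← real_inner_self_eq_norm_sq, plane_inner, sq, sq]

/-- A rotated gradient `(-∂₂ψ, ∂₁ψ)`, `ψ ∈ H¹₀(Ω)`, is divergence free. -/
theorem inner_rot_grad_eq_zero {Ω : BoundedOpenSet} (ψ v : H10 Ω) :
    inner ℝ (rot.compLp (H10.grad Ω ψ)) (H10.grad Ω v) = 0 := by
  have hcl : IsClosed {q : L2 Ω.carrier × L2Field Ω.carrier |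
      inner ℝ (rot.compLp (H10.grad Ω ψ)) q.2 = 0} :=
    isClosed_eq (by fun_prop) (by fun_prop)
  refine closure_minimal ?_ hcl v.2
  rintro q ⟨φ, hφ, -, hq⟩
  rw [mem_ofPred_eq, L2.inner_def]
  set e : Fin 2 → Plane := fun i => EuclideanSpace.single i 1
  have hd : ∀ i, IsTestFunction Ω.carrier (fun x => fderiv ℝ φ x (e i)) := fun i =>
    ⟨(hφ.1.fderiv_right (m := ∞) (by simp)).clm_apply contDiff_const, hφ.2.1.fderiv_apply ℝ _,
      (tsupport_fderiv_apply_subset ℝ _).trans hφ.2.2⟩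
  have hw := hasWeakGradient_of_mem ψ.2
  have h01 := hw _ (hd 1) (e 0)
  have h10 := hw _ (hd 0) (e 1)
  have hsymm : ∀ x, fderiv ℝ (fun y => fderiv ℝ φ y (e 1)) x (e 0) =
      fderiv ℝ (fun y => fderiv ℝ φ y (e 0)) x (e 1) := fun x => by
    have hdiff : DifferentiableAt ℝ (fderiv ℝ φ) x :=
      (hφ.1.fderiv_right (m := ∞) (by simp)).differentiable (by simp) x
    have hs : IsSymmSndFDerivAt ℝ φ x := hφ.1.contDiffAt.isSymmSndFDerivAt (by
      rw [minSmoothness_of_isRCLikeNormedField]; exact WithTop.coe_le_coe.2 (le_top : (2 : ℕ∞) ≤ ⊤))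
    rw [fderiv_clm_apply hdiff (differentiableAt_const _),
      fderiv_clm_apply hdiff (differentiableAt_const _)]
    simpa using hs.eq (e 0) (e 1)
  simp only [hsymm] at h01
  rw [h10, neg_inj] at h01
  have hint : ∀ i j, Integrable (fun x => inner ℝ (e i) (ψ.1.2 x) * fderiv ℝ φ x (e j))
      (volume.restrict Ω.carrier) := fun i j => by
    have m1 : MemLp (fun x => inner ℝ (e i) (ψ.1.2 x)) 2 (volume.restrict Ω.carrier) :=
      (Lp.memLp ψ.1.2).const_inner (e i)
    have m2 : MemLp (fun x => fderiv ℝ φ x (e j)) 2 (volume.restrict Ω.carrier) :=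
      ((hd j).1.continuous.memLp_of_hasCompactSupport (hd j).2.1).restrict _
    exact m1.integrable_mul m2
  have he : ∀ i (x : Plane), inner ℝ (e i) x = x i := fun i x => by
    simp [e, EuclideanSpace.inner_single_left]
  calc ∫ x in Ω.carrier, inner ℝ (rot.compLp (H10.grad Ω ψ) x) (q.2 x)
      = ∫ x in Ω.carrier, (inner ℝ (e 0) (ψ.1.2 x) * fderiv ℝ φ x (e 1) -
          inner ℝ (e 1) (ψ.1.2 x) * fderiv ℝ φ x (e 0)) := by
        refine integral_congr_ae ?_
        filter_upwards [hq, rot.coeFn_compLp (H10.grad Ω ψ)] with x h1 h2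
        have hg : ∀ i, (∇ φ x) i = fderiv ℝ φ x (e i) := fun i => by
          rw [← he, inner_gradient_right]; simp
        rw [h1, h2, plane_inner, rot_zero_apply, rot_one_apply, hg, hg, he, he]
        change -(ψ.1.2 x 1) * _ + ψ.1.2 x 0 * _ = _
        ring
    _ = 0 := by rw [integral_sub (hint 0 1) (hint 1 0), h01, sub_self]

theorem norm_toLp_sq {U : Set Plane} {f : Plane → Plane} (hf : MemLp f 2 (volume.restrict U)) :
    ‖hf.toLp f‖ ^ 2 = ∫ x in U, ‖f x‖ ^ 2 := by
  rw [← real_inner_self_eq_norm_sq, L2.inner_def]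
  refine integral_congr_ae ?_
  filter_upwards [hf.coeFn_toLp] with x hx
  rw [hx, real_inner_self_eq_norm_sq]

theorem memLp_indicator_grad {Ω : BoundedOpenSet} {A : Set Plane} (hA : MeasurableSet A)
    (u : H10 Ω) : MemLp (A.indicator (H10.grad Ω u)) 2 (volume.restrict Ω.carrier) :=
  (Lp.memLp _).indicator hA

/-- `T_A u` is the projection of `1_A ∇u` onto the gradients. -/
theorem inner_poincareOp_eq {Ω : BoundedOpenSet} {A : Set Plane} (hA : MeasurableSet A)
    (hAΩ : A ⊆ Ω.carrier) (u v : H10 Ω) :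
    inner ℝ (poincareOp Ω A u) v =
      inner ℝ ((memLp_indicator_grad hA u).toLp _) (H10.grad Ω v) := by
  have hμ : volume.restrict A = (volume.restrict Ω.carrier).restrict A := by
    rw [Measure.restrict_restrict hA, inter_eq_left.2 hAΩ]
  rw [H10.inner_eq, poincareOp_spec Ω hA hAΩ, L2.inner_def, hμ, ← integral_indicator hA]
  refine integral_congr_ae ?_
  filter_upwards [(memLp_indicator_grad hA u).coeFn_toLp] with x h1
  rw [h1]
  by_cases hx : x ∈ A <;> simp [hx]

/-- An element of `H¹₀(Ω)` that represents the field `f` is bounded by `f`. -/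
theorem norm_le_of_inner_eq {Ω : BoundedOpenSet} {w : H10 Ω} {f : L2Field Ω.carrier}
    (h : ∀ v, inner ℝ w v = inner ℝ f (H10.grad Ω v)) : ‖w‖ ≤ ‖f‖ := by
  rcases (norm_nonneg w).eq_or_lt with h0 | h0
  · rw [← h0]; exact norm_nonneg _
  · have h1 := real_inner_le_norm f (H10.grad Ω w)
    rw [← h w, real_inner_self_eq_norm_sq, H10.norm_grad, sq] at h1
    exact le_of_mul_le_mul_right h1 h0

/-- The residual `T_G u - β u` represents the field `(1_G - β) ∇u`, and does so modulo
divergence-free fields. -/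
theorem norm_poincareOp_sub_sq_le {Ω : BoundedOpenSet} {G : Set Plane} (hG : MeasurableSet G)
    (hGΩ : G ⊆ Ω.carrier) (β : ℝ) (u ψ : H10 Ω) :
    ‖poincareOp Ω G u - β • u‖ ^ 2 ≤ ∫ x in Ω.carrier,
      ‖(G.indicator (fun _ => (1 : ℝ)) x - β) • H10.grad Ω u x - rot (H10.grad Ω ψ x)‖ ^ 2 := by
  have m1 := memLp_indicator_grad hG u
  have m3 : MemLp (fun x => rot (H10.grad Ω ψ x)) 2 (volume.restrict Ω.carrier) :=
    rot.comp_memLp' (Lp.memLp _)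
  have mF : MemLp (fun x => (G.indicator (fun _ => (1 : ℝ)) x - β) • H10.grad Ω u x -
      rot (H10.grad Ω ψ x)) 2 (volume.restrict Ω.carrier) := by
    refine ((m1.sub ((Lp.memLp (H10.grad Ω u)).const_smul β)).sub m3).ae_eq (ae_of_all _ fun x => ?_)
    by_cases hx : x ∈ G <;> simp [hx, sub_smul]
  rw [← norm_toLp_sq mF]
  refine pow_le_pow_left₀ (norm_nonneg _) (norm_le_of_inner_eq fun v => ?_) 2
  have h0 : mF.toLp _ =
      m1.toLp _ - β • H10.grad Ω u - rot.compLp (H10.grad Ω ψ) := by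
    refine Lp.ext ?_
    filter_upwards [mF.coeFn_toLp, m1.coeFn_toLp, rot.coeFn_compLp (H10.grad Ω ψ),
      Lp.coeFn_sub (m1.toLp _ - β • H10.grad Ω u) (rot.compLp (H10.grad Ω ψ)),
      Lp.coeFn_sub (m1.toLp _) (β • H10.grad Ω u), Lp.coeFn_smul β (H10.grad Ω u)]
      with x h1 h2 h3 h4 h5 h6
    rw [h1, h4, Pi.sub_apply, h3, h5, Pi.sub_apply, h2, h6]
    by_cases hx : x ∈ G <;> simp [hx, sub_smul]
  rw [h0, inner_sub_left, inner_sub_left, inner_sub_left, inner_rot_grad_eq_zero, sub_zero,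
    inner_poincareOp_eq hG hGΩ, real_inner_smul_left, real_inner_smul_left]
  rfl

/-- Continuity of `G ↦ T_G u` with respect to the measure of the symmetric difference. -/
theorem norm_poincareOp_sub_poincareOp_sq_le {Ω : BoundedOpenSet} {G D : Set Plane}
    (hG : MeasurableSet G) (hD : MeasurableSet D)
    (hGΩ : G ⊆ Ω.carrier) (hDΩ : D ⊆ Ω.carrier) (u : H10 Ω) :
    ‖poincareOp Ω G u - poincareOp Ω D u‖ ^ 2 ≤
      ∫ x in symmDiff G D, ‖H10.grad Ω u x‖ ^ 2 ∂(volume.restrict Ω.carrier) := by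
  have mG := memLp_indicator_grad hG u
  have mD := memLp_indicator_grad hD u
  have hn : ‖(mG.sub mD).toLp _‖ ^ 2 =
      ∫ x in symmDiff G D, ‖H10.grad Ω u x‖ ^ 2 ∂(volume.restrict Ω.carrier) := by
    rw [norm_toLp_sq, ← integral_indicator (hG.symmDiff hD)]
    refine integral_congr_ae (ae_of_all _ fun x => ?_)
    by_cases h1 : x ∈ G <;> by_cases h2 : x ∈ D <;> simp [h1, h2, mem_symmDiff]
  rw [← hn]
  refine pow_le_pow_left₀ (norm_nonneg _) (norm_le_of_inner_eq fun v => ?_) 2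
  rw [MemLp.toLp_sub, inner_sub_left, inner_sub_left, inner_poincareOp_eq hG hGΩ,
    inner_poincareOp_eq hD hDΩ]

/-! ### Lipschitz functions in the energy space -/

theorem norm_gradient (f : Plane → ℝ) (x : Plane) : ‖∇ f x‖ = ‖fderiv ℝ f x‖ := by
  simp [gradient]

theorem measurable_gradient (f : Plane → ℝ) : Measurable (∇ f) :=
  (InnerProductSpace.toDual ℝ Plane).symm.continuous.measurable.comp (measurable_fderiv ℝ f)

theorem memLp_of_bounded {U : Set Plane} (hU : Bornology.IsBounded U) {f : Plane → Plane}
    (hf : Measurable f) {K : ℝ} (hK : ∀ x, ‖f x‖ ≤ K) : MemLp f 2 (volume.restrict U) := by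
  have : IsFiniteMeasure (volume.restrict U) := ⟨by simpa using hU.measure_lt_top⟩
  exact MemLp.of_bound hf.aestronglyMeasurable K (ae_of_all _ hK)

/-- The gradient of a test function is the gradient of an element of `H¹₀(Ω)`. -/
theorem toLp_gradient_mem_range {Ω : BoundedOpenSet} {φ : Plane → ℝ}
    (hφ : IsTestFunction Ω.carrier φ) (h : MemLp (∇ φ) 2 (volume.restrict Ω.carrier)) :
    h.toLp _ ∈ range (H10.gradₗᵢ (Ω := Ω)) := by
  have m : MemLp φ 2 (volume.restrict Ω.carrier) :=
    (hφ.1.continuous.memLp_of_hasCompactSupport hφ.2.1).restrict _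
  exact ⟨⟨(m.toLp _, h.toLp _), subset_closure ⟨φ, hφ, m.coeFn_toLp, h.coeFn_toLp⟩⟩, rfl⟩

/-- The derivative of `ρ ⋆ f` falls on the Lipschitz factor: by Rademacher's theorem the difference
quotients of `f` converge almost everywhere, and they are bounded. -/
theorem hasFDerivAt_convolution_of_lipschitz {ρ f : Plane → ℝ} (hρ : Continuous ρ)
    (hρc : HasCompactSupport ρ) (hρ0 : ∀ x, 0 ≤ ρ x) {K : ℝ≥0} (hf : LipschitzWith K f)
    (x : Plane) :
    HasFDerivAt (convolution ρ f (ContinuousLinearMap.lsmul ℝ ℝ) volume)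
      (convolution ρ (fderiv ℝ f) (ContinuousLinearMap.lsmul ℝ ℝ) volume x) x := by
  have hρi : Integrable ρ := hρ.integrable_of_hasCompactSupport hρc
  refine (hasFDerivAt_integral_of_dominated_loc_of_lip (s := univ)
    (F := fun x t => ContinuousLinearMap.lsmul ℝ ℝ (ρ t) (f (x - t)))
    (F' := fun t => ContinuousLinearMap.lsmul ℝ ℝ (ρ t) (fderiv ℝ f (x - t)))
    (bound := fun t => ρ t * K) univ_mem (Eventually.of_forall fun y => ?_) ?_ ?_
    (ae_of_all _ fun t => ?_) (hρi.mul_const _) ?_).2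
  · exact (hρ.smul (hf.continuous.comp (continuous_const.sub continuous_id))).aestronglyMeasurable
  · exact (hρ.smul (hf.continuous.comp
      (continuous_const.sub continuous_id))).integrable_of_hasCompactSupport hρc.smul_right
  · exact (hρ.measurable.smul ((measurable_fderiv ℝ f).comp
      (measurable_const.sub measurable_id))).aestronglyMeasurable
  · refine LipschitzOnWith.of_dist_le_mul fun y _ z _ => ?_
    have h1 := hf.dist_le_mul (y - t) (z - t)
    rw [dist_sub_right] at h1
    simp only [ContinuousLinearMap.lsmul_apply, dist_smul₀, Real.coe_nnabs,
      Real.norm_of_nonneg (hρ0 t)]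
    rw [abs_of_nonneg (mul_nonneg (hρ0 t) K.coe_nonneg), mul_assoc]
    exact mul_le_mul_of_nonneg_left h1 (hρ0 t)
  · have hmp : MeasurePreserving (fun t : Plane => x - t) volume volume :=
      Measure.measurePreserving_sub_left volume x
    filter_upwards [hmp.quasiMeasurePreserving.ae (hf.ae_differentiableAt (μ := volume))] with t ht
    have h1 : HasFDerivAt (fun y : Plane => f (y - t)) (fderiv ℝ f (x - t)) x :=
      ht.hasFDerivAt.comp x ((hasFDerivAt_id x).sub_const t)
    exact h1.const_smul (ρ t)

/-- A compactly supported Lipschitz function on `Ω` lies in `H¹₀(Ω)`, with its almost everywhere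
defined classical gradient; this follows by mollification. -/
theorem exists_grad_ae_eq {Ω : BoundedOpenSet} {f : Plane → ℝ} {K : ℝ≥0} (hf : LipschitzWith K f)
    (hc : HasCompactSupport f) (hs : tsupport f ⊆ Ω.carrier) :
    ∃ w : H10 Ω, H10.grad Ω w =ᵐ[volume.restrict Ω.carrier] ∇ f := by
  have hb : ∀ x, ‖fderiv ℝ f x‖ ≤ K := fun x => norm_fderiv_le_of_lipschitz ℝ hf
  have mf : MemLp (∇ f) 2 (volume.restrict Ω.carrier) :=
    memLp_of_bounded Ω.isBounded (measurable_gradient f) fun x => (norm_gradient f x).trans_le (hb x)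
  suffices h : mf.toLp _ ∈ range (H10.gradₗᵢ (Ω := Ω)) by
    obtain ⟨w, hw⟩ := h
    refine ⟨w, ?_⟩
    have : H10.grad Ω w = mf.toLp _ := hw
    rw [this]
    exact mf.coeFn_toLp
  -- gradients of elements of `H¹₀(Ω)` form a closed subspace, so it is enough to approximate `∇ f`
  have hcl : IsClosed (range (H10.gradₗᵢ (Ω := Ω))) :=
    (H10.gradₗᵢ (Ω := Ω)).isometry.isClosedEmbedding.isClosed_range
  let φ : ℕ → ContDiffBump (0 : Plane) := fun n =>
    ⟨1 / ((n : ℝ) + 1), 2 * (1 / ((n : ℝ) + 1)), by positivity, by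
      have : 0 < 1 / ((n : ℝ) + 1) := by positivity
      linarith⟩
  have hφ0 : Tendsto (fun n => (φ n).rOut) atTop (𝓝 0) := by
    have := (tendsto_one_div_add_atTop_nhds_zero_nat (𝕜 := ℝ)).const_mul 2
    rwa [mul_zero] at this
  set ρ : ℕ → Plane → ℝ := fun n => (φ n).normed volume
  have hρ0 : ∀ n x, 0 ≤ ρ n x := fun n x => (φ n).nonneg_normed x
  have hρs : ∀ n, ContDiff ℝ ∞ (ρ n) := fun n => (φ n).contDiff_normed
  have hρc : ∀ n, HasCompactSupport (ρ n) := fun n => (φ n).hasCompactSupport_normed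
  set F : ℕ → Plane → ℝ := fun n =>
    convolution (ρ n) f (ContinuousLinearMap.lsmul ℝ ℝ) volume
  have hFd : ∀ n x, fderiv ℝ (F n) x =
      convolution (ρ n) (fderiv ℝ f) (ContinuousLinearMap.lsmul ℝ ℝ) volume x := fun n x =>
    (hasFDerivAt_convolution_of_lipschitz (hρs n).continuous (hρc n) (hρ0 n) hf x).fderiv
  have hFb : ∀ n x, ‖fderiv ℝ (F n) x‖ ≤ K := fun n x => by
    rw [hFd, convolution_def]
    have hi : Integrable (ρ n) := (hρs n).continuous.integrable_of_hasCompactSupport (hρc n)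
    refine (norm_integral_le_of_norm_le (hi.mul_const (K : ℝ)) (ae_of_all _ fun t => ?_)).trans_eq ?_
    · rw [ContinuousLinearMap.lsmul_apply, norm_smul, Real.norm_of_nonneg (hρ0 n t)]
      exact mul_le_mul_of_nonneg_left (hb _) (hρ0 n t)
    · rw [integral_mul_const, (φ n).integral_normed, one_mul]
  have hloc : LocallyIntegrable (fderiv ℝ f) (volume : Measure Plane) := fun x =>
    ⟨Metric.closedBall x 1, Metric.closedBall_mem_nhds x one_pos,
      Measure.integrableOn_of_bounded (measure_closedBall_lt_top).ne
        (measurable_fderiv ℝ f).aestronglyMeasurable (ae_of_all _ hb)⟩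
  have hae : ∀ᵐ x ∂(volume : Measure Plane),
      Tendsto (fun n => fderiv ℝ (F n) x) atTop (𝓝 (fderiv ℝ f x)) := by
    have := ContDiffBump.ae_convolution_tendsto_right_of_locallyIntegrable (μ := volume)
      (φ := φ) (K := 2) hφ0 (Eventually.of_forall fun n => le_rfl) hloc
    simpa only [hFd] using this
  have mF : ∀ n, MemLp (∇ (F n)) 2 (volume.restrict Ω.carrier) := fun n =>
    memLp_of_bounded Ω.isBounded (measurable_gradient _) fun x =>
      (norm_gradient _ x).trans_le (hFb n x)
  have htest : ∀ᶠ n in atTop, IsTestFunction Ω.carrier (F n) := by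
    obtain ⟨δ, hδ, hδΩ⟩ := hc.isCompact.exists_cthickening_subset_open Ω.isOpen hs
    filter_upwards [hφ0.eventually (gt_mem_nhds hδ)] with n hn
    refine ⟨(hρc n).contDiff_convolution_left _ (n := ⊤) (hρs n) hf.continuous.locallyIntegrable,
      (hρc n).convolution _ hc, ?_⟩
    refine (closure_minimal ?_ Metric.isClosed_cthickening).trans hδΩ
    refine (support_convolution_subset _).trans ?_
    rintro _ ⟨y, hy, z, hz, rfl⟩
    refine Metric.mem_cthickening_of_dist_le (y + z) z δ _ (subset_tsupport f hz) ?_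
    have : y ∈ Metric.ball (0 : Plane) (φ n).rOut := by
      rw [← (φ n).support_normed_eq (μ := volume)]; exact hy
    rw [dist_eq_norm, add_sub_cancel_right]
    exact (mem_ball_zero_iff.1 this).le.trans hn.le
  refine hcl.mem_of_tendsto (f := fun n => (mF n).toLp _) (b := atTop) ?_
    (htest.mono fun n hn => toLp_gradient_mem_range hn (mF n))
  rw [tendsto_iff_norm_sub_tendsto_zero]
  have hsq : Tendsto (fun n => ‖(mF n).toLp _ - mf.toLp _‖ ^ 2) atTop (𝓝 0) := by
    have e : ∀ n, ‖(mF n).toLp _ - mf.toLp _‖ ^ 2 =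
        ∫ x in Ω.carrier, ‖(∇ (F n) - ∇ f) x‖ ^ 2 := fun n => by
      rw [← MemLp.toLp_sub, norm_toLp_sq]
    simp only [e]
    have : IsFiniteMeasure (volume.restrict Ω.carrier) :=
      ⟨by simpa using Ω.isBounded.measure_lt_top⟩
    rw [← integral_zero Plane ℝ (μ := volume.restrict Ω.carrier)]
    refine tendsto_integral_of_dominated_convergence (fun _ => ((K : ℝ) + K) ^ 2)
      (fun n => ?_) (integrable_const _) (fun n => ae_of_all _ fun x => ?_) ?_
    · exact (((measurable_gradient _).sub (measurable_gradient _)).norm.pow_const 2).aestronglyMeasurable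
    · rw [Real.norm_of_nonneg (by positivity), Pi.sub_apply]
      refine pow_le_pow_left₀ (norm_nonneg _) ((norm_sub_le _ _).trans ?_) 2
      rw [norm_gradient, norm_gradient]
      exact add_le_add (hFb n x) (hb x)
    · filter_upwards [ae_restrict_of_ae hae] with x hx
      have h1 : Tendsto (fun n => ∇ (F n) x) atTop (𝓝 (∇ f x)) :=
        ((InnerProductSpace.toDual ℝ Plane).symm.continuous.tendsto _).comp hx
      have h2 := ((h1.sub_const (∇ f x)).norm).pow 2
      simpa using h2
  have := hsq.sqrt
  simpa [Real.sqrt_sq] using this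

/-! ### Lower semicontinuity of the spectrum as the wings separate -/

/-- The horizontal vector of length `a`. -/
def horiz (a : ℝ) : Plane := !₂[a, 0]

theorem continuous_horiz : Continuous horiz := by
  unfold horiz
  refine (PiLp.continuous_toLp 2 _).comp (continuous_pi fun i => ?_)
  fin_cases i <;> simp <;> fun_prop

theorem norm_horiz (a : ℝ) : ‖horiz a‖ = |a| := by
  rw [← abs_of_nonneg (norm_nonneg (horiz a)), ← sq_eq_sq_iff_abs_eq_abs, plane_norm_sq]
  simp [horiz]

theorem horiz_zero : horiz 0 = 0 := by
  rw [← norm_eq_zero, norm_horiz, abs_zero]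

theorem separated_eq (D₁ D₂ : Set Plane) (δ : ℝ) :
    separated D₁ D₂ δ =
      (fun x => horiz (δ / 2) + x) '' D₁ ∪ (fun x => horiz (-δ / 2) + x) '' D₂ := rfl

theorem isOpen_separated {D₁ D₂ : Set Plane} (h₁ : IsOpen D₁) (h₂ : IsOpen D₂) (δ : ℝ) :
    IsOpen (separated D₁ D₂ δ) :=
  ((isOpenMap_add_left _) _ h₁).union ((isOpenMap_add_left _) _ h₂)

theorem eventually_closure_separated_subset {Ω : BoundedOpenSet} {D₁ D₂ : Set Plane}
    (hDΩ : closure (D₁ ∪ D₂) ⊆ Ω.carrier) :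
    ∀ᶠ δ in 𝓝 (0 : ℝ), closure (separated D₁ D₂ δ) ⊆ Ω.carrier := by
  have hK : IsCompact (closure (D₁ ∪ D₂)) :=
    Metric.isCompact_of_isClosed_isBounded isClosed_closure (Ω.isBounded.subset hDΩ)
  obtain ⟨ε, hε, hεΩ⟩ := hK.exists_cthickening_subset_open Ω.isOpen hDΩ
  filter_upwards [Metric.ball_mem_nhds (0 : ℝ) hε] with δ hδ
  rw [mem_ball_zero_iff, Real.norm_eq_abs] at hδ
  refine (closure_minimal ?_ Metric.isClosed_cthickening).trans hεΩ
  have h : ∀ a : ℝ, |a| ≤ |δ| → ∀ x ∈ D₁ ∪ D₂,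
      horiz a + x ∈ Metric.cthickening ε (closure (D₁ ∪ D₂)) := fun a ha x hx => by
    refine Metric.mem_cthickening_of_dist_le _ x ε _ (subset_closure hx) ?_
    rw [dist_eq_norm, add_sub_cancel_right, norm_horiz]
    exact ha.trans hδ.le
  rw [separated_eq]
  rintro _ (⟨x, hx, rfl⟩ | ⟨x, hx, rfl⟩)
  · refine h _ ?_ x (Or.inl hx)
    rw [abs_div, abs_two]
    linarith [abs_nonneg δ]
  · refine h _ ?_ x (Or.inr hx)
    rw [abs_div, abs_neg, abs_two]
    linarith [abs_nonneg δ]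

theorem tendsto_measure_symmDiff_translate {D : Set Plane} (hD : MeasurableSet D)
    (hb : volume D ≠ ⊤) {a : ℝ → ℝ} (ha : Continuous a) (h0 : a 0 = 0) :
    Tendsto (fun δ => volume (symmDiff ((fun x => horiz (a δ) + x) '' D) D)) (𝓝 0) (𝓝 0) := by
  have hc : Continuous (fun p : ℝ × Plane => -horiz (a p.1) + p.2) :=
    ((continuous_horiz.comp (ha.comp continuous_fst)).neg).add continuous_snd
  let f : C(ℝ, C(Plane, Plane)) := ContinuousMap.curry ⟨_, hc⟩
  have h := tendsto_measure_symmDiff_preimage_nhds_zero (μ := (volume : Measure Plane))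
    (ν := volume) (f := f) (g := f 0) (s := D) (f.continuous.tendsto 0)
    (Eventually.of_forall fun δ => measurePreserving_add_left volume (-horiz (a δ)))
    (measurePreserving_add_left volume (-horiz (a 0))) hD.nullMeasurableSet hb
  refine h.congr fun δ => ?_
  have e1 : f δ ⁻¹' D = (fun x => horiz (a δ) + x) '' D := by
    rw [image_add_left]; rfl
  have e2 : f 0 ⁻¹' D = D := by
    ext x
    change -horiz (a 0) + x ∈ D ↔ _
    rw [h0, horiz_zero, neg_zero, zero_add]
  rw [e1, e2]

theorem tendsto_measure_symmDiff_separated {D₁ D₂ : Set Plane} (h₁ : IsOpen D₁) (h₂ : IsOpen D₂)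
    (hb : volume (D₁ ∪ D₂) ≠ ⊤) :
    Tendsto (fun δ => volume (symmDiff (separated D₁ D₂ δ) (D₁ ∪ D₂))) (𝓝 0) (𝓝 0) := by
  have t₁ := tendsto_measure_symmDiff_translate h₁.measurableSet
    (ne_top_of_le_ne_top hb (measure_mono subset_union_left)) (a := fun δ => δ / 2)
    (by fun_prop) (by simp)
  have t₂ := tendsto_measure_symmDiff_translate h₂.measurableSet
    (ne_top_of_le_ne_top hb (measure_mono subset_union_right)) (a := fun δ => -δ / 2)
    (by fun_prop) (by simp)
  have t := t₁.add t₂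
  rw [add_zero] at t
  refine tendsto_of_tendsto_of_tendsto_of_le_of_le tendsto_const_nhds t (fun _ => zero_le)
    fun δ => (measure_mono ?_).trans (measure_union_le _ _)
  rw [separated_eq]
  intro x hx
  simp only [mem_symmDiff, mem_union] at hx ⊢
  tauto

/-- Every spectral value of the touching bowtie is approximated by those of `D_δ`: an approximate
eigenvector of `T_D` is one of `T_{D_δ}` for small `δ`. -/
theorem eventually_exists_mem_spectrum_near {Ω : BoundedOpenSet} {D₁ D₂ : Set Plane}
    (h₁ : IsOpen D₁) (h₂ : IsOpen D₂) (hDΩ : closure (D₁ ∪ D₂) ⊆ Ω.carrier) {β : ℝ}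
    (hβ : β ∈ spectrum ℝ (poincareOp Ω (D₁ ∪ D₂))) {ε : ℝ} (hε : 0 < ε) :
    ∀ᶠ δ in 𝓝 (0 : ℝ), ∃ b ∈ spectrum ℝ (poincareOp Ω (separated D₁ D₂ δ)), |b - β| < ε := by
  obtain ⟨u, hu⟩ := exists_approx_of_mem_spectrum (poincareOp_symm Ω _) hβ hε
  have hDΩ' := subset_closure.trans hDΩ
  have hb : volume (D₁ ∪ D₂) ≠ ⊤ := (Ω.isBounded.subset hDΩ').measure_lt_top.ne
  have hi : Integrable (fun x => ‖H10.grad Ω u x‖ ^ 2) (volume.restrict Ω.carrier) :=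
    (Lp.memLp (H10.grad Ω u)).integrable_norm_pow two_ne_zero
  have t := hi.tendsto_setIntegral_nhds_zero (l := 𝓝 (0 : ℝ))
    (s := fun δ => symmDiff (separated D₁ D₂ δ) (D₁ ∪ D₂))
    (tendsto_of_tendsto_of_tendsto_of_le_of_le tendsto_const_nhds
      (tendsto_measure_symmDiff_separated h₁ h₂ hb) (fun _ => zero_le)
      fun δ => Measure.restrict_apply_le _ _)
  set g := ε * ‖u‖ - ‖poincareOp Ω (D₁ ∪ D₂) u - β • u‖
  have hg : 0 < g := sub_pos.2 hu
  filter_upwards [t.eventually (gt_mem_nhds (show 0 < g ^ 2 by positivity)),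
    eventually_closure_separated_subset hDΩ] with δ h3 h4
  refine exists_mem_spectrum_near (poincareOp_symm Ω _) (u₀ := u) ?_
  have h5 := (norm_poincareOp_sub_poincareOp_sq_le (isOpen_separated h₁ h₂ δ).measurableSet
    (h₁.union h₂).measurableSet (subset_closure.trans h4) hDΩ' u).trans_lt h3
  have h6 := lt_of_pow_lt_pow_left₀ 2 hg.le h5
  have h7 := norm_add_le (poincareOp Ω (separated D₁ D₂ δ) u - poincareOp Ω (D₁ ∪ D₂) u)
    (poincareOp Ω (D₁ ∪ D₂) u - β • u)
  rw [sub_add_sub_cancel] at h7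
  linarith

theorem spectrum_subset_limitSpectrum {Ω : BoundedOpenSet} {D₁ D₂ : Set Plane}
    (h₁ : IsOpen D₁) (h₂ : IsOpen D₂) (hDΩ : closure (D₁ ∪ D₂) ⊆ Ω.carrier) :
    spectrum ℝ (poincareOp Ω (D₁ ∪ D₂)) ⊆ limitSpectrum Ω D₁ D₂ := by
  intro β hβ
  have h0 := tendsto_one_div_add_atTop_nhds_zero_nat (𝕜 := ℝ)
  have hp : ∀ n : ℕ, ∀ᶠ k : ℕ in atTop,
      closure (separated D₁ D₂ (1 / ((k : ℝ) + 1))) ⊆ Ω.carrier ∧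
      ∃ b ∈ spectrum ℝ (poincareOp Ω (separated D₁ D₂ (1 / ((k : ℝ) + 1)))),
        |b - β| < 1 / ((n : ℝ) + 1) := fun n =>
    h0.eventually ((eventually_closure_separated_subset hDΩ).and
      (eventually_exists_mem_spectrum_near h₁ h₂ hDΩ hβ (by positivity)))
  obtain ⟨k, hk, hkp⟩ := extraction_forall_of_eventually hp
  choose hc b hb hbβ using hkp
  refine ⟨fun n => 1 / ((k n : ℝ) + 1), b, fun n => ⟨by positivity, hc n⟩, fun m n hmn => ?_,
    h0.comp hk.tendsto_atTop, hb, ?_⟩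
  · have : (k m : ℝ) ≤ k n := by exact_mod_cast hk.monotone hmn
    exact one_div_le_one_div_of_le (by positivity) (by linarith)
  · rw [tendsto_iff_norm_sub_tendsto_zero]
    exact squeeze_zero (fun _ => norm_nonneg _) (fun n => (hbβ n).le) h0

theorem limitSpectrum_subset_Icc (Ω : BoundedOpenSet) (D₁ D₂ : Set Plane) :
    limitSpectrum Ω D₁ D₂ ⊆ Icc 0 1 := by
  rintro β ⟨δ, b, -, -, -, hb, ht⟩
  exact isClosed_Icc.mem_of_tendsto ht
    (Eventually.of_forall fun n => spectrum_poincareOp_subset Ω _ (hb n))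

/-! ### Locally Lipschitz functions -/

/-- `f` is Lipschitz on a neighbourhood of `x`. -/
def LipAt {E F : Type*} [PseudoEMetricSpace E] [PseudoEMetricSpace F] (f : E → F) (x : E) : Prop :=
  ∃ K, ∃ t ∈ 𝓝 x, LipschitzOnWith K f t

section LipAt

variable {E F G : Type*} [PseudoEMetricSpace E] [PseudoEMetricSpace F] [PseudoEMetricSpace G]

theorem LipAt.comp {g : F → G} {f : E → F} {x : E} (hg : LipAt g (f x)) (hf : LipAt f x) :
    LipAt (fun y => g (f y)) x := by
  obtain ⟨K, t, ht, hK⟩ := hg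
  obtain ⟨L, s, hs, hL⟩ := hf
  have hc : ContinuousAt f x := hL.continuousOn.continuousAt hs
  refine ⟨K * L, s ∩ f ⁻¹' t, inter_mem hs (hc ht), ?_⟩
  exact hK.comp (hL.mono inter_subset_left) fun y hy => hy.2

theorem LipAt.prodMk {f : E → F} {g : E → G} {x : E} (hf : LipAt f x) (hg : LipAt g x) :
    LipAt (fun y => (f y, g y)) x := by
  obtain ⟨K, t, ht, hK⟩ := hf
  obtain ⟨L, s, hs, hL⟩ := hg
  exact ⟨max K L, t ∩ s, inter_mem ht hs,
    (hK.mono inter_subset_left).prodMk (hL.mono inter_subset_right)⟩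

theorem LipAt.congr {f g : E → F} {x : E} (hf : LipAt f x) (h : g =ᶠ[𝓝 x] f) : LipAt g x := by
  obtain ⟨K, t, ht, hK⟩ := hf
  refine ⟨K, t ∩ {y | g y = f y}, inter_mem ht h, fun y hy z hz => ?_⟩
  rw [hy.2, hz.2]
  exact hK hy.1 hz.1

theorem LipAt.mul {f g : E → ℝ} {x : E} (hf : LipAt f x) (hg : LipAt g x) :
    LipAt (fun y => f y * g y) x :=
  LipAt.comp (g := fun p : ℝ × ℝ => p.1 * p.2)
    (contDiff_mul (𝕜 := ℝ) (n := 1)).contDiffAt.exists_lipschitzOnWith (hf.prodMk hg)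

end LipAt

theorem LipAt.of_contDiffAt {E F : Type*} [NormedAddCommGroup E] [NormedSpace ℝ E]
    [NormedAddCommGroup F] [NormedSpace ℝ F] {f : E → F} {x : E} (h : ContDiffAt ℝ 1 f x) :
    LipAt f x := h.exists_lipschitzOnWith

/-- A locally Lipschitz function vanishing outside a ball is globally Lipschitz. -/
theorem exists_lipschitzWith_of_support {f : Plane → ℝ} (hf : ∀ x, LipAt f x) {R : ℝ}
    (hR : ∀ x, R < ‖x‖ → f x = 0) : ∃ K, LipschitzWith K f := by
  have hc : IsCompact (Metric.closedBall (0 : Plane) (R + 1)) := isCompact_closedBall _ _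
  have hl : LocallyLipschitz f := hf
  obtain ⟨K, hK⟩ := hl.locallyLipschitzOn.exists_lipschitzOnWith_of_compact hc
  obtain ⟨M, hM⟩ := hc.exists_bound_of_continuousOn hl.continuous.continuousOn
  have hM' : ∀ x, ‖f x‖ ≤ max M 0 := fun x => by
    by_cases hx : ‖x‖ ≤ R + 1
    · exact (hM x (mem_closedBall_zero_iff.2 hx)).trans (le_max_left _ _)
    · rw [hR x (by linarith), norm_zero]; exact le_max_right _ _
  have hKM : (max K ⟨max M 0, le_max_right _ _⟩ : ℝ≥0) = max (K : ℝ) (max M 0) := rfl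
  have key : ∀ x y : Plane, R + 1 < ‖y‖ →
      dist (f x) (f y) ≤ (max K ⟨max M 0, le_max_right _ _⟩ : ℝ≥0) * dist x y := fun x y hy => by
    rw [hR y (by linarith), dist_zero_right]
    by_cases hx : R < ‖x‖
    · rw [hR x hx, norm_zero]; positivity
    · have h1 : 1 ≤ dist x y := by
        rw [dist_comm, dist_eq_norm]
        have := norm_sub_norm_le y x
        linarith
      calc ‖f x‖ ≤ max M 0 * 1 := by rw [mul_one]; exact hM' x
        _ ≤ _ := by
          rw [hKM]
          exact mul_le_mul (le_max_right _ _) h1 zero_le_one (le_max_of_le_left K.2)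
  refine ⟨max K ⟨max M 0, le_max_right _ _⟩, LipschitzWith.of_dist_le_mul fun x y => ?_⟩
  by_cases hy : R + 1 < ‖y‖
  · exact key x y hy
  by_cases hx : R + 1 < ‖x‖
  · rw [dist_comm, dist_comm x]; exact key y x hx
  refine (hK.dist_le_mul x (mem_closedBall_zero_iff.2 (not_lt.1 hx)) y
    (mem_closedBall_zero_iff.2 (not_lt.1 hy))).trans ?_
  rw [hKM]
  exact mul_le_mul_of_nonneg_right (le_max_left _ _) dist_nonneg

/-! ### The quasi-periodic solutions on a double sector -/

/-- The projection of `ℝ` onto `[-s, s]`. -/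
def clamp (s z : ℝ) : ℝ := max (-s) (min s z)

theorem abs_clamp_le {s : ℝ} (hs : 0 ≤ s) (z : ℝ) : |clamp s z| ≤ s :=
  abs_le.2 ⟨le_max_left _ _, max_le (by linarith) (min_le_left _ _)⟩

theorem clamp_of_abs_le {s z : ℝ} (h : |z| ≤ s) : clamp s z = z := by
  rw [abs_le] at h
  rw [clamp, min_eq_right h.2, max_eq_right h.1]

theorem clamp_of_le_abs {s z : ℝ} (hs : 0 ≤ s) (h : s ≤ |z|) : clamp s z = SignType.sign z * s := by
  rcases lt_trichotomy z 0 with hz | hz | hz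
  · rw [abs_of_neg hz] at h
    rw [clamp, min_eq_right (by linarith), max_eq_left (by linarith), sign_neg hz]
    simp
  · rw [hz, abs_zero] at h
    rw [hz, le_antisymm h hs]; simp [clamp]
  · rw [abs_of_pos hz] at h
    rw [clamp, min_eq_left h, max_eq_right (by linarith), sign_pos hz]
    simp

theorem lipAt_clamp (s z : ℝ) : LipAt (clamp s) z :=
  ⟨1, univ, univ_mem, ((LipschitzWith.id.const_min s).const_max (-s)).lipschitzOnWith⟩

/-- The angle between `x` and the axis `{x i = 0}`, in `[-π/2, π/2]`, truncated to `[-c, c]`. -/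
def angle (i : Fin 2) (c : ℝ) (x : Plane) : ℝ :=
  Real.arcsin (clamp (Real.sin c) (x i / ‖x‖))

theorem lipAt_angle {i : Fin 2} {c : ℝ} (hc0 : 0 < c) (hc : c < Real.pi / 2) {x : Plane}
    (hx : x ≠ 0) : LipAt (angle i c) x := by
  have hs0 : 0 < Real.sin c := Real.sin_pos_of_pos_of_lt_pi hc0 (by linarith [Real.pi_pos])
  have hs1 : Real.sin c < 1 := by
    rw [← Real.sin_pi_div_two]
    exact Real.sin_lt_sin_of_lt_of_le_pi_div_two (by linarith) le_rfl hc
  have hb := abs_le.1 (abs_clamp_le hs0.le (x i / ‖x‖))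
  refine LipAt.comp (g := Real.arcsin) (f := fun x : Plane => clamp (Real.sin c) (x i / ‖x‖))
    (LipAt.of_contDiffAt (Real.contDiffAt_arcsin (by linarith) (by linarith))) ?_
  refine LipAt.comp (g := clamp (Real.sin c)) (f := fun x : Plane => x i / ‖x‖)
    (lipAt_clamp _ _) (LipAt.of_contDiffAt ?_)
  exact ContDiffAt.div (by fun_prop) (contDiffAt_norm ℝ hx) (norm_ne_zero_iff.2 hx)

/-- The function `k(log r) cosh(η θᵢ) sinh(η θⱼ)`, normalized, where the truncation of the angles
`θᵢ`, `θⱼ` to the two axes makes one of the two hyperbolic factors constant in each sector. -/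
def wave (η : ℝ) (i j : Fin 2) (c d : ℝ) (k : ℝ → ℝ) (x : Plane) : ℝ :=
  k (Real.log ‖x‖) * (Real.cosh (η * angle i c x) / Real.cosh (η * c) *
    (Real.sinh (η * angle j d x) / Real.sinh (η * d)))

theorem lipAt_wave {η : ℝ} {i j : Fin 2} {c d : ℝ} {k : ℝ → ℝ} (hc0 : 0 < c)
    (hc : c < Real.pi / 2) (hd0 : 0 < d) (hd : d < Real.pi / 2) (hk : ContDiff ℝ 1 k) {x : Plane}
    (hx : x ≠ 0) : LipAt (wave η i j c d k) x := by
  refine LipAt.mul (LipAt.of_contDiffAt ?_) (LipAt.mul ?_ ?_)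
  · exact hk.contDiffAt.comp x ((contDiffAt_norm ℝ hx).log (norm_ne_zero_iff.2 hx))
  · exact LipAt.comp (g := fun z => Real.cosh (η * z) / Real.cosh (η * c))
      (LipAt.of_contDiffAt (by fun_prop)) (lipAt_angle hc0 hc hx)
  · exact LipAt.comp (g := fun z => Real.sinh (η * z) / Real.sinh (η * d))
      (LipAt.of_contDiffAt (by fun_prop)) (lipAt_angle hd0 hd hx)

theorem wave_zero (η : ℝ) (i j : Fin 2) (c d : ℝ) (k : ℝ → ℝ) (hd0 : 0 < d) (hd : d < Real.pi / 2) :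
    wave η i j c d k 0 = 0 := by
  have hs0 : 0 < Real.sin d := Real.sin_pos_of_pos_of_lt_pi hd0 (by linarith [Real.pi_pos])
  simp [wave, angle, clamp_of_abs_le (show |(0 : ℝ)| ≤ Real.sin d by simpa using hs0.le)]

theorem wave_eq_zero {η : ℝ} {i j : Fin 2} {c d : ℝ} {k : ℝ → ℝ} {t₀ t₁ : ℝ}
    (hk : ∀ t, t ≤ t₀ ∨ t₁ ≤ t → k t = 0) (hd0 : 0 < d) (hd : d < Real.pi / 2) {x : Plane}
    (hx : ‖x‖ ≤ Real.exp t₀ ∨ Real.exp t₁ ≤ ‖x‖) : wave η i j c d k x = 0 := by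
  by_cases h0 : x = 0
  · rw [h0, wave_zero _ _ _ _ _ _ hd0 hd]
  · have hp : 0 < ‖x‖ := norm_pos_iff.2 h0
    rw [wave, hk, zero_mul]
    exact hx.imp (fun h => (Real.log_le_iff_le_exp hp).2 h) fun h => (Real.le_log_iff_exp_le hp).2 h

/-- A wave with amplitude `k` supported in `[t₀, t₁]` lies in the energy space. -/
theorem exists_grad_eq_wave {Ω : BoundedOpenSet} {η : ℝ} {i j : Fin 2} {c d : ℝ} {k : ℝ → ℝ}
    {t₀ t₁ : ℝ} (hk : ContDiff ℝ 1 k) (hk0 : ∀ t, t ≤ t₀ ∨ t₁ ≤ t → k t = 0) (hc0 : 0 < c)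
    (hc : c < Real.pi / 2) (hd0 : 0 < d) (hd : d < Real.pi / 2)
    (hΩ : Metric.closedBall 0 (Real.exp t₁) ⊆ Ω.carrier) :
    ∃ w : H10 Ω, H10.grad Ω w =ᵐ[volume.restrict Ω.carrier] ∇ (wave η i j c d k) := by
  have hl : ∀ x, LipAt (wave η i j c d k) x := fun x => by
    by_cases hx : x = 0
    · rw [hx]
      refine LipAt.congr (f := fun _ => 0) (LipAt.of_contDiffAt contDiffAt_const) ?_
      filter_upwards [Metric.ball_mem_nhds (0 : Plane) (Real.exp_pos t₀)] with y hy
      exact wave_eq_zero hk0 hd0 hd (Or.inl (mem_ball_zero_iff.1 hy).le)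
    · exact lipAt_wave hc0 hc hd0 hd hk hx
  have hsupp : Function.support (wave η i j c d k) ⊆ Metric.closedBall 0 (Real.exp t₁) := by
    intro x hx
    by_contra h
    rw [mem_closedBall_zero_iff, not_le] at h
    exact hx (wave_eq_zero hk0 hd0 hd (Or.inr h.le))
  obtain ⟨K, hK⟩ := exists_lipschitzWith_of_support hl (R := Real.exp t₁)
    fun x hx => wave_eq_zero hk0 hd0 hd (Or.inr hx.le)
  exact exists_grad_ae_eq hK (HasCompactSupport.of_support_subset_isCompact
    (isCompact_closedBall _ _) hsupp) ((closure_minimal hsupp Metric.isClosed_closedBall).trans hΩ)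

/-! ### Gradients in polar coordinates -/

/-- The gradient `x / |x|²` of `log |x|`. -/
def rad (x : Plane) : Plane := (‖x‖ ^ 2)⁻¹ • x

/-- The gradient of the polar angle. -/
def ang (x : Plane) : Plane := rot (rad x)

theorem rot_rot (x : Plane) : rot (rot x) = -x := by
  ext i; fin_cases i <;> simp

theorem norm_sq_rad_add_ang (x : Plane) (p q : ℝ) :
    ‖p • rad x + q • ang x‖ ^ 2 = (p ^ 2 + q ^ 2) * (‖x‖ ^ 2)⁻¹ := by
  by_cases hx : x = 0
  · simp [hx, rad, ang]
  have h : x 0 ^ 2 + x 1 ^ 2 ≠ 0 := by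
    rw [← plane_norm_sq]; exact pow_ne_zero 2 (norm_ne_zero_iff.2 hx)
  rw [plane_norm_sq, plane_norm_sq]
  simp only [rad, ang, PiLp.add_apply, PiLp.smul_apply, map_smul, rot_zero_apply, rot_one_apply,
    smul_eq_mul, plane_norm_sq]
  field_simp
  ring

theorem hasGradientAt_log_norm {x : Plane} (hx : x ≠ 0) :
    HasGradientAt (fun y => Real.log ‖y‖) (rad x) x := by
  have hn : ‖x‖ ^ 2 ≠ 0 := pow_ne_zero 2 (norm_ne_zero_iff.2 hx)
  have h1 := ((hasStrictFDerivAt_norm_sq x).hasFDerivAt.log hn).const_mul (1 / 2 : ℝ)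
  have e : (fun y : Plane => Real.log ‖y‖) = fun y => 1 / 2 * Real.log (‖y‖ ^ 2) := by
    ext y
    rw [Real.log_pow]
    push_cast
    ring
  rw [hasGradientAt_iff_hasFDerivAt, e]
  refine h1.congr_fderiv ?_
  ext y
  simp [rad]
  ring

/-- The sign by which the gradient of the angle to the axis `{x i = 0}` differs from that of the
polar angle. -/
def orient (i : Fin 2) (x : Plane) : ℝ :=
  if i = 1 then SignType.sign (x 0) else -SignType.sign (x 1)

theorem hasGradientAt_coord_div_norm {x : Plane} (hx : x ≠ 0) (i : Fin 2) :
    HasGradientAt (fun y : Plane => y i / ‖y‖)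
      ((if i = 1 then x 0 / ‖x‖ else -(x 1 / ‖x‖)) • ang x) x := by
  have hn : 0 < ‖x‖ := norm_pos_iff.2 hx
  have hl := (hasGradientAt_iff_hasFDerivAt.1 (hasGradientAt_log_norm hx)).neg.exp
  have hp : HasFDerivAt (fun y : Plane => y i) (EuclideanSpace.proj i : Plane →L[ℝ] ℝ) x :=
    (EuclideanSpace.proj i : Plane →L[ℝ] ℝ).hasFDerivAt
  rw [hasGradientAt_iff_hasFDerivAt]
  -- `y i / ‖y‖` is differentiated as the product of `y i` and `exp (-log ‖y‖)`
  have e : ∀ y : Plane, y ≠ 0 → Real.exp (-Real.log ‖y‖) = ‖y‖⁻¹ := fun y hy => by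
    rw [Real.exp_neg, Real.exp_log (norm_pos_iff.2 hy)]
  have h := (hp.mul hl).congr_of_eventuallyEq (f₁ := fun y : Plane => y i / ‖y‖) (by
    filter_upwards [isOpen_ne.mem_nhds hx] with y hy
    change y i / ‖y‖ = y i * Real.exp (-Real.log ‖y‖)
    rw [e y hy, div_eq_mul_inv])
  refine h.congr_fderiv (Eq.symm ?_)
  rw [Pi.neg_apply, e x hx]
  have hx2 := plane_norm_sq x
  have hn2 : ‖x‖ ^ 2 ≠ 0 := by positivity
  ext v
  simp only [map_smul, smul_apply, add_apply,
    InnerProductSpace.toDual_apply_apply, ang, rad, neg_apply, smul_eq_mul,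
    plane_inner, rot_zero_apply, rot_one_apply, PiLp.proj_apply,
    smul_neg]
  fin_cases i
  · simp
    field_simp
    rw [hx2]; ring
  · simp
    field_simp
    rw [hx2]; ring

theorem hasGradientAt_angle {i : Fin 2} {c : ℝ} (hc0 : 0 < c) (hc : c < Real.pi / 2) {x : Plane}
    (hx : x ≠ 0) (h : |x i| < Real.sin c * ‖x‖) :
    HasGradientAt (angle i c) (orient i x • ang x) x := by
  have hn : 0 < ‖x‖ := norm_pos_iff.2 hx
  have hs1 : Real.sin c < 1 := by
    rw [← Real.sin_pi_div_two]
    exact Real.sin_lt_sin_of_lt_of_le_pi_div_two (by linarith) le_rfl hc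
  have hq : |x i / ‖x‖| < Real.sin c := by
    rwa [abs_div, abs_of_pos hn, div_lt_iff₀ hn]
  have hcont : ContinuousAt (fun y : Plane => |y i / ‖y‖|) x :=
    (ContinuousAt.div (by fun_prop) continuous_norm.continuousAt hn.ne').abs
  have hev : angle i c =ᶠ[𝓝 x] fun y => Real.arcsin (y i / ‖y‖) := by
    filter_upwards [hcont.eventually (gt_mem_nhds hq)] with y hy
    rw [angle, clamp_of_abs_le hy.le]
  have hq' := abs_lt.1 hq
  have h1 := (Real.hasDerivAt_arcsin (x := x i / ‖x‖) (by linarith) (by linarith)).comp_hasFDerivAt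
    x (hasGradientAt_iff_hasFDerivAt.1 (hasGradientAt_coord_div_norm hx i))
  refine HasGradientAt.congr_of_eventuallyEq (hasGradientAt_iff_hasFDerivAt.2 ?_) hev
  refine h1.congr_fderiv (Eq.symm ?_)
  rw [← map_smul, smul_smul]
  congr 2
  have hsq : ∀ z w : ℝ, z ^ 2 + w ^ 2 = ‖x‖ ^ 2 → w ≠ 0 →
      1 / √(1 - (z / ‖x‖) ^ 2) * (w / ‖x‖) = SignType.sign w := fun z w hzw hw => by
    have e : 1 - (z / ‖x‖) ^ 2 = (|w| / ‖x‖) ^ 2 := by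
      rw [div_pow, div_pow, sq_abs, ← hzw]
      have : z ^ 2 + w ^ 2 ≠ 0 := by rw [hzw]; positivity
      field_simp
      ring
    rw [e, Real.sqrt_sq (by positivity)]
    have hw' : |w| ≠ 0 := abs_ne_zero.2 hw
    have := sign_mul_abs w
    field_simp
    rw [mul_comm]
    exact this.symm
  have hi : x i ^ 2 < ‖x‖ ^ 2 := by
    rw [← sq_abs]
    refine pow_lt_pow_left₀ (h.trans ?_) (abs_nonneg _) two_ne_zero
    exact (mul_lt_iff_lt_one_left hn).2 hs1
  rw [plane_norm_sq] at hi
  fin_cases i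
  · have hw : x 1 ≠ 0 := fun h0 => by simp [h0] at hi
    have := hsq (x 0) (x 1) (plane_norm_sq x).symm hw
    simp only [orient, Fin.zero_eta, Fin.isValue, zero_ne_one, if_false, mul_neg, this]
  · have hw : x 0 ≠ 0 := fun h0 => by simp [h0] at hi
    have := hsq (x 1) (x 0) (by rw [plane_norm_sq]; ring) hw
    simp only [orient, Fin.mk_one, Fin.isValue, if_true, this]

theorem angle_eventuallyEq {i : Fin 2} {c : ℝ} (hc0 : 0 < c) (hc : c < Real.pi / 2) {x : Plane}
    (hx : x ≠ 0) (h : Real.sin c * ‖x‖ < |x i|) :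
    angle i c =ᶠ[𝓝 x] fun _ => SignType.sign (x i) * c := by
  have hn : 0 < ‖x‖ := norm_pos_iff.2 hx
  have hs0 : 0 < Real.sin c := Real.sin_pos_of_pos_of_lt_pi hc0 (by linarith [Real.pi_pos])
  have hq : Real.sin c < |x i / ‖x‖| := by rwa [abs_div, abs_of_pos hn, lt_div_iff₀ hn]
  have hxi : x i ≠ 0 := fun h0 => by
    rw [h0, abs_zero] at h
    exact absurd h (not_lt.2 (by positivity))
  have hc1 : ContinuousAt (fun y : Plane => y i) x := by fun_prop
  have hcont : ContinuousAt (fun y : Plane => |y i / ‖y‖|) x :=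
    (ContinuousAt.div hc1 continuous_norm.continuousAt hn.ne').abs
  have hsgn : ∀ᶠ y : Plane in 𝓝 x, SignType.sign (y i) = SignType.sign (x i) := by
    rcases lt_or_gt_of_ne hxi with hlt | hgt
    · filter_upwards [hc1.eventually (gt_mem_nhds hlt)] with y hy
      rw [sign_neg hy, sign_neg hlt]
    · filter_upwards [hc1.eventually (lt_mem_nhds hgt)] with y hy
      rw [sign_pos hy, sign_pos hgt]
  have harc : Real.arcsin (Real.sin c) = c := Real.arcsin_sin (by linarith) hc.le
  filter_upwards [hcont.eventually (lt_mem_nhds hq), hsgn, isOpen_ne.mem_nhds hx] with y hy hy2 hy3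
  have hn' : 0 < ‖y‖ := norm_pos_iff.2 hy3
  have hs : SignType.sign (y i / ‖y‖) = SignType.sign (y i) := by
    rw [div_eq_mul_inv, sign_mul, sign_pos (inv_pos.2 hn'), mul_one]
  rw [angle, clamp_of_le_abs hs0.le hy.le, hs, hy2]
  rcases lt_or_gt_of_ne hxi with hlt | hgt
  · rw [sign_neg hlt]; simp [Real.arcsin_neg, harc]
  · rw [sign_pos hgt]; simp [harc]

/-- The gradient of a product of a function of `log |x|` and a function of an angle `θ`. -/
theorem hasGradientAt_polar {x : Plane} (hx : x ≠ 0) {k g : ℝ → ℝ} {θ : Plane → ℝ}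
    {k' g' σ : ℝ} (hk : HasDerivAt k k' (Real.log ‖x‖)) (hg : HasDerivAt g g' (θ x))
    (hθ : HasGradientAt θ (σ • ang x) x) :
    HasGradientAt (fun y => k (Real.log ‖y‖) * g (θ y))
      ((k' * g (θ x)) • rad x + (k (Real.log ‖x‖) * (g' * σ)) • ang x) x := by
  have h1 := hk.comp_hasFDerivAt x (hasGradientAt_iff_hasFDerivAt.1 (hasGradientAt_log_norm hx))
  have h2 := hg.comp_hasFDerivAt x (hasGradientAt_iff_hasFDerivAt.1 hθ)
  rw [hasGradientAt_iff_hasFDerivAt]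
  refine (h1.mul h2).congr_fderiv (Eq.symm ?_)
  simp only [map_add, map_smul, smul_smul, Function.comp_apply]
  rw [add_comm]
  congr 1
  ring_nf

/-! ### Gradients of the waves -/

/-- In the sectors around the axis `{x i = 0}` the wave is even in the angle to that axis. -/
theorem hasGradientAt_wave_even {η : ℝ} {i j : Fin 2} {c d : ℝ} {k : ℝ → ℝ} {k' : ℝ} (hη : 0 < η)
    (hc0 : 0 < c) (hc : c < Real.pi / 2) (hd0 : 0 < d) (hd : d < Real.pi / 2) {x : Plane}
    (hx : x ≠ 0) (hi : |x i| < Real.sin c * ‖x‖) (hj : Real.sin d * ‖x‖ < |x j|)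
    (hk : HasDerivAt k k' (Real.log ‖x‖)) :
    HasGradientAt (wave η i j c d k)
      ((k' * (SignType.sign (x j) * (Real.cosh (η * angle i c x) / Real.cosh (η * c)))) • rad x +
        (k (Real.log ‖x‖) * (SignType.sign (x j) *
          (η * Real.sinh (η * angle i c x) / Real.cosh (η * c)) * orient i x)) • ang x) x := by
  have hs0 : 0 < Real.sin d := Real.sin_pos_of_pos_of_lt_pi hd0 (by linarith [Real.pi_pos])
  have hxj : x j ≠ 0 := fun h0 => by
    rw [h0, abs_zero] at hj
    exact absurd hj (not_lt.2 (by positivity))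
  have hsd : Real.sinh (η * d) ≠ 0 := (Real.sinh_pos_iff.2 (by positivity)).ne'
  have hsgn : Real.sinh (η * (SignType.sign (x j) * d)) / Real.sinh (η * d) =
      SignType.sign (x j) := by
    rcases lt_or_gt_of_ne hxj with h | h
    · rw [sign_neg h]; simp [hsd]
    · rw [sign_pos h]; simp [hsd]
  have hg : HasDerivAt (fun z => SignType.sign (x j) * (Real.cosh (η * z) / Real.cosh (η * c)))
      (SignType.sign (x j) * (η * Real.sinh (η * angle i c x) / Real.cosh (η * c)))
      (angle i c x) := by
    have h1 := ((Real.hasDerivAt_cosh (η * angle i c x)).comp (angle i c x)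
      ((hasDerivAt_id _).const_mul η)).div_const (Real.cosh (η * c))
    refine (h1.const_mul _).congr_deriv ?_
    ring
  refine (hasGradientAt_polar hx hk hg (hasGradientAt_angle hc0 hc hx hi)).congr_of_eventuallyEq ?_
  filter_upwards [angle_eventuallyEq hd0 hd hx hj] with y hy
  rw [wave, hy, hsgn]
  ring

/-- In the sectors around the axis `{x j = 0}` the wave is odd in the angle to that axis. -/
theorem hasGradientAt_wave_odd {η : ℝ} {i j : Fin 2} {c d : ℝ} {k : ℝ → ℝ} {k' : ℝ}
    (hc0 : 0 < c) (hc : c < Real.pi / 2) (hd0 : 0 < d) (hd : d < Real.pi / 2) {x : Plane}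
    (hx : x ≠ 0) (hi : Real.sin c * ‖x‖ < |x i|) (hj : |x j| < Real.sin d * ‖x‖)
    (hk : HasDerivAt k k' (Real.log ‖x‖)) :
    HasGradientAt (wave η i j c d k)
      ((k' * (Real.sinh (η * angle j d x) / Real.sinh (η * d))) • rad x +
        (k (Real.log ‖x‖) * (η * Real.cosh (η * angle j d x) / Real.sinh (η * d) *
          orient j x)) • ang x) x := by
  have hs0 : 0 < Real.sin c := Real.sin_pos_of_pos_of_lt_pi hc0 (by linarith [Real.pi_pos])
  have hxi : x i ≠ 0 := fun h0 => by
    rw [h0, abs_zero] at hi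
    exact absurd hi (not_lt.2 (by positivity))
  have hcosh : Real.cosh (η * (SignType.sign (x i) * c)) / Real.cosh (η * c) = 1 := by
    rcases lt_or_gt_of_ne hxi with h | h
    · rw [sign_neg h]; simp [(Real.cosh_pos _).ne']
    · rw [sign_pos h]; simp [(Real.cosh_pos _).ne']
  have hg : HasDerivAt (fun z => Real.sinh (η * z) / Real.sinh (η * d))
      (η * Real.cosh (η * angle j d x) / Real.sinh (η * d)) (angle j d x) := by
    have h1 := ((Real.hasDerivAt_sinh (η * angle j d x)).comp (angle j d x)
      ((hasDerivAt_id _).const_mul η)).div_const (Real.sinh (η * d))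
    refine h1.congr_deriv ?_
    ring
  refine (hasGradientAt_polar hx hk hg (hasGradientAt_angle hd0 hd hx hj)).congr_of_eventuallyEq ?_
  filter_upwards [angle_eventuallyEq hc0 hc hx hi] with y hy
  rw [wave, hy, hcosh, one_mul]

theorem sign_mul_self_of_ne_zero {z : ℝ} (hz : z ≠ 0) :
    (SignType.sign z : ℝ) * SignType.sign z = 1 := by
  rcases lt_or_gt_of_ne hz with h | h
  · rw [sign_neg h]; simp
  · rw [sign_pos h]; simp

set_option maxHeartbeats 400000 in
/-- The transmission problem for the coefficient `1 - β` on the double sector `|x₂| < sin a |x|`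
and `-β` off it. The hypothesis `hdisp` is the dispersion relation, under which the flux of
the first wave is the rotated gradient of a multiple of the second one when `l' = η k` and
`k' = -η l`. Here `g` and `g'` are the angular profile of the first wave and its derivative. -/
theorem exists_wave_gradients {a γ η β : ℝ} (ha : 0 < a) (hγ : 0 < γ) (haγ : a + γ = Real.pi / 2)
    (hη : 0 < η) (hdisp : (1 - β) * (Real.sinh (η * a) * Real.sinh (η * γ)) =
      β * (Real.cosh (η * a) * Real.cosh (η * γ))) :
    ∃ m M : ℝ, 0 < m ∧ 0 ≤ M ∧ ∀ x : Plane, x ≠ 0 → |x 1| ≠ Real.sin a * ‖x‖ →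
      ∃ g g' : ℝ, m ≤ g ^ 2 + g' ^ 2 ∧ g ^ 2 + g' ^ 2 ≤ M ∧ ∀ (k l : ℝ → ℝ) (k' l' : ℝ),
        HasDerivAt k k' (Real.log ‖x‖) → HasDerivAt l l' (Real.log ‖x‖) →
        ∇ (wave η 1 0 a γ k) x = (k' * g) • rad x + (k (Real.log ‖x‖) * g') • ang x ∧
        ((1 - β) * (Real.sinh (η * a) / Real.cosh (η * a))) • ∇ (wave η 0 1 γ a l) x =
          (if |x 1| < Real.sin a * ‖x‖ then 1 - β else -β) •
            ((l' * g' / η) • rad x + (l (Real.log ‖x‖) * η * g) • ang x) := by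
  have ha' : a < Real.pi / 2 := by linarith
  have hγ' : γ < Real.pi / 2 := by linarith
  have hsγ : Real.sin γ = Real.cos a := by
    rw [← Real.sin_pi_div_two_sub]; congr 1; linarith
  have hsa0 : 0 < Real.sin a := Real.sin_pos_of_pos_of_lt_pi ha (by linarith [Real.pi_pos])
  have hsγ0 : 0 < Real.sin γ := Real.sin_pos_of_pos_of_lt_pi hγ (by linarith [Real.pi_pos])
  set ca := Real.cosh (η * a)
  set sa := Real.sinh (η * a)
  set cγ := Real.cosh (η * γ)
  set sγ := Real.sinh (η * γ)
  have ca0 : 0 < ca := Real.cosh_pos _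
  have cγ0 : 0 < cγ := Real.cosh_pos _
  have sa0 : 0 < sa := Real.sinh_pos_iff.2 (by positivity)
  have sγ0 : 0 < sγ := Real.sinh_pos_iff.2 (by positivity)
  set Z := Real.cosh (η * (Real.pi / 2))
  have hZ : ∀ i c x, Real.cosh (η * angle i c x) ^ 2 ≤ Z ^ 2 := fun i c x => by
    refine pow_le_pow_left₀ (Real.cosh_pos _).le (Real.cosh_le_cosh.2 ?_) 2
    rw [abs_mul, abs_mul, abs_of_pos Real.pi_div_two_pos]
    exact mul_le_mul_of_nonneg_left
      (abs_le.2 ⟨Real.neg_pi_div_two_le_arcsin _, Real.arcsin_le_pi_div_two _⟩) (abs_nonneg _)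
  have hsc : ∀ z : ℝ, Real.sinh z ^ 2 = Real.cosh z ^ 2 - 1 := fun z => Real.sinh_sq z
  refine ⟨min (1 / ca ^ 2) (η ^ 2 / sγ ^ 2), (1 + η ^ 2) * Z ^ 2 * (1 / ca ^ 2 + 1 / sγ ^ 2),
    by positivity, by positivity, fun x hx hbd => ?_⟩
  have hn : 0 < ‖x‖ := norm_pos_iff.2 hx
  have hx2 : x 0 ^ 2 + x 1 ^ 2 = ‖x‖ ^ 2 := (plane_norm_sq x).symm
  have htrig := Real.sin_sq_add_cos_sq a
  rw [← hsγ] at htrig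
  have hsum : (Real.sin a * ‖x‖) ^ 2 + (Real.sin γ * ‖x‖) ^ 2 = x 0 ^ 2 + x 1 ^ 2 := by
    rw [hx2, mul_pow, mul_pow, ← add_mul, htrig, one_mul]
  by_cases h1 : |x 1| < Real.sin a * ‖x‖
  -- inside the double sector the truncated angle to the vertical axis is constant
  · have h0 : Real.sin γ * ‖x‖ < |x 0| := by
      refine lt_of_pow_lt_pow_left₀ 2 (abs_nonneg _) ?_
      rw [sq_abs]
      have := pow_lt_pow_left₀ h1 (abs_nonneg _) two_ne_zero
      rw [sq_abs] at this
      linarith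
    have hx0 : x 0 ≠ 0 := fun h => by
      rw [h, abs_zero] at h0
      exact absurd h0 (not_lt.2 (by positivity))
    have hs := sign_mul_self_of_ne_zero hx0
    set s : ℝ := SignType.cast (SignType.sign (x 0))
    set y := η * angle 1 a x
    have hor : orient 1 x = s := by simp [orient, s]
    have hs2 : s ^ 2 = 1 := by rw [sq, hs]
    have hg : (s * (Real.cosh y / ca)) ^ 2 = Real.cosh y ^ 2 / ca ^ 2 := by
      rw [mul_pow, hs2, one_mul, div_pow]
    have hg' : (s * (η * Real.sinh y / ca) * orient 1 x) ^ 2 =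
        η ^ 2 * (Real.cosh y ^ 2 - 1) / ca ^ 2 := by
      rw [hor, mul_pow, mul_pow, hs2, one_mul, mul_one, div_pow, mul_pow, hsc]
    have hy1 : 1 ≤ Real.cosh y ^ 2 := one_le_pow₀ (Real.one_le_cosh y)
    refine ⟨s * (Real.cosh y / ca), s * (η * Real.sinh y / ca) * orient 1 x, ?_, ?_,
      fun k l k' l' hk hl => ⟨?_, ?_⟩⟩
    · rw [hg, hg', ← add_div]
      refine (min_le_left _ _).trans (div_le_div_of_nonneg_right ?_ (by positivity))
      linarith [mul_nonneg (sq_nonneg η) (sub_nonneg.2 hy1)]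
    · rw [hg, hg', ← add_div]
      calc (Real.cosh y ^ 2 + η ^ 2 * (Real.cosh y ^ 2 - 1)) / ca ^ 2
          ≤ (1 + η ^ 2) * Z ^ 2 / ca ^ 2 := by
            refine div_le_div_of_nonneg_right ?_ (by positivity)
            linarith [mul_le_mul_of_nonneg_left (hZ 1 a x) (sq_nonneg η), hZ 1 a x, sq_nonneg η]
        _ ≤ _ := by
            rw [mul_add, mul_one_div]
            exact le_add_of_nonneg_right (by positivity)
    · exact (hasGradientAt_wave_even hη ha ha' hγ hγ' hx h1 h0 hk).gradient
    · rw [(hasGradientAt_wave_odd hγ hγ' ha ha' hx h0 h1 hl).gradient, if_pos h1, hor,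
        smul_add, smul_add, smul_smul, smul_smul, smul_smul, smul_smul]
      congr 2
      · change (1 - β) * (sa / ca) * (l' * (Real.sinh y / sa)) = _
        field_simp
        rw [hs2, mul_one]
      · change (1 - β) * (sa / ca) * (l (Real.log ‖x‖) * (η * Real.cosh y / sa * s)) = _
        field_simp
  -- outside it the truncated angle to the horizontal axis is constant
  · have h1' : Real.sin a * ‖x‖ < |x 1| := lt_of_le_of_ne (not_lt.1 h1) hbd.symm
    have h0 : |x 0| < Real.sin γ * ‖x‖ := by
      refine lt_of_pow_lt_pow_left₀ 2 (by positivity) ?_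
      rw [sq_abs]
      have := pow_lt_pow_left₀ h1' (by positivity) two_ne_zero
      rw [sq_abs] at this
      linarith
    have hx1 : x 1 ≠ 0 := fun h => by
      rw [h, abs_zero] at h1'
      exact absurd h1' (not_lt.2 (by positivity))
    have hs := sign_mul_self_of_ne_zero hx1
    set s : ℝ := SignType.cast (SignType.sign (x 1))
    set y := η * angle 0 γ x
    have hor : orient 0 x = -s := by simp [orient, s]
    have hs2 : s ^ 2 = 1 := by rw [sq, hs]
    have hg : (Real.sinh y / sγ) ^ 2 = (Real.cosh y ^ 2 - 1) / sγ ^ 2 := by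
      rw [div_pow, hsc]
    have hg' : (η * Real.cosh y / sγ * orient 0 x) ^ 2 = η ^ 2 * Real.cosh y ^ 2 / sγ ^ 2 := by
      rw [hor, mul_pow, neg_sq, hs2, mul_one, div_pow, mul_pow]
    have hy1 : 1 ≤ Real.cosh y ^ 2 := one_le_pow₀ (Real.one_le_cosh y)
    refine ⟨Real.sinh y / sγ, η * Real.cosh y / sγ * orient 0 x, ?_, ?_,
      fun k l k' l' hk hl => ⟨?_, ?_⟩⟩
    · rw [hg, hg', ← add_div]
      refine (min_le_right _ _).trans (div_le_div_of_nonneg_right ?_ (by positivity))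
      linarith [mul_nonneg (sq_nonneg η) (sub_nonneg.2 hy1)]
    · rw [hg, hg', ← add_div]
      calc (Real.cosh y ^ 2 - 1 + η ^ 2 * Real.cosh y ^ 2) / sγ ^ 2
          ≤ (1 + η ^ 2) * Z ^ 2 / sγ ^ 2 := by
            refine div_le_div_of_nonneg_right ?_ (by positivity)
            linarith [mul_le_mul_of_nonneg_left (hZ 0 γ x) (sq_nonneg η), hZ 0 γ x]
        _ ≤ _ := by
            rw [mul_add, mul_one_div, mul_one_div]
            exact le_add_of_nonneg_left (by positivity)
    · exact (hasGradientAt_wave_odd ha ha' hγ hγ' hx h1' h0 hk).gradient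
    · rw [(hasGradientAt_wave_even hη hγ hγ' ha ha' hx h0 h1' hl).gradient, if_neg h1, hor,
        smul_add, smul_add, smul_smul, smul_smul, smul_smul, smul_smul]
      have hκ : (1 - β) * (sa / ca) = β * (cγ / sγ) := by
        field_simp
        linarith
      rw [hκ]
      congr 2
      · change β * (cγ / sγ) * (l' * (s * (Real.cosh y / cγ))) = _
        field_simp
      · change β * (cγ / sγ) * (l (Real.log ‖x‖) * (s * (η * Real.sinh y / cγ) * -s)) = _
        field_simp
        rw [hs2, mul_one]

/-- The dispersion relation `tanh (η a) tanh (η γ) = β / (1 - β)` is solvable for `0 < β < 1/2`, since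
the left-hand side increases from `0` to `1`. -/
theorem exists_dispersion {a γ β : ℝ} (ha : 0 < a) (hγ : 0 < γ) (hβ0 : 0 < β) (hβ : β < 1 / 2) :
    ∃ η, 0 < η ∧ (1 - β) * (Real.sinh (η * a) * Real.sinh (η * γ)) =
      β * (Real.cosh (η * a) * Real.cosh (η * γ)) := by
  have hr : β / (1 - β) < 1 := (div_lt_one (by linarith)).2 (by linarith)
  obtain ⟨q, hq0, hq1, hq⟩ : ∃ q : ℝ, 0 < q ∧ q < 1 ∧ β / (1 - β) < q * q := by
    refine ⟨(1 + β / (1 - β)) / 2, ?_, by linarith, ?_⟩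
    · have : 0 < β / (1 - β) := div_pos hβ0 (by linarith)
      linarith
    · nlinarith [sq_pos_of_pos (sub_pos.2 hr)]
  set f : ℝ → ℝ := fun η => (1 - β) * (Real.sinh (η * a) * Real.sinh (η * γ)) -
    β * (Real.cosh (η * a) * Real.cosh (η * γ))
  have hfc : Continuous f := by fun_prop
  have hlarge : ∀ {c : ℝ}, 0 < c → ∀ N, Real.artanh q ≤ N * c →
      q * Real.cosh (N * c) ≤ Real.sinh (N * c) := fun {c} _ N hN => by
    have h1 : q ≤ Real.tanh (N * c) := by
      rw [← Real.tanh_artanh (show q ∈ Ioo (-1) 1 from ⟨by linarith, hq1⟩)]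
      rwa [← Real.artanh_le_artanh_iff ⟨Real.neg_one_lt_tanh _, Real.tanh_lt_one _⟩
        ⟨Real.neg_one_lt_tanh _, Real.tanh_lt_one _⟩, Real.artanh_tanh, Real.artanh_tanh]
    rwa [Real.tanh_eq_sinh_div_cosh, le_div_iff₀ (Real.cosh_pos _)] at h1
  set A := Real.artanh q
  have hA : 0 < A := Real.artanh_pos ⟨hq0, hq1⟩
  set N := A / a + A / γ
  have hN : 0 < N := by positivity
  have hNa : A ≤ N * a := by
    have : N * a = A + A / γ * a := by simp only [N]; field_simp
    rw [this]; exact le_add_of_nonneg_right (by positivity)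
  have hNγ : A ≤ N * γ := by
    have : N * γ = A / a * γ + A := by simp only [N]; field_simp
    rw [this]; exact le_add_of_nonneg_left (by positivity)
  have hf0 : f 0 < 0 := by simp [f, hβ0]
  have hfN : 0 < f N := by
    have h1 := mul_le_mul (hlarge ha N hNa) (hlarge hγ N hNγ)
      (mul_nonneg hq0.le (Real.cosh_pos _).le) (Real.sinh_nonneg_iff.2 (by positivity))
    have h2 : 0 < Real.cosh (N * a) * Real.cosh (N * γ) :=
      mul_pos (Real.cosh_pos _) (Real.cosh_pos _)
    rw [div_lt_iff₀ (by linarith)] at hq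
    have h3 := mul_lt_mul_of_pos_right hq h2
    have h4 := mul_le_mul_of_nonneg_left h1 (show 0 ≤ 1 - β by linarith)
    simp only [f]
    linarith
  obtain ⟨η, ⟨hη0, -⟩, hη⟩ := intermediate_value_Ioo hN.le hfc.continuousOn ⟨hf0, hfN⟩
  exact ⟨η, hη0, sub_eq_zero.1 hη⟩

/-! ### Singular sequences on logarithmic annuli -/

/-- The closed annulus `s ≤ log |x| ≤ t`. -/
def annulus (s t : ℝ) : Set Plane := {x | Real.exp s ≤ ‖x‖ ∧ ‖x‖ ≤ Real.exp t}

theorem mem_annulus_iff {s t : ℝ} {x : Plane} (hx : x ≠ 0) :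
    x ∈ annulus s t ↔ Real.log ‖x‖ ∈ Icc s t := by
  have hn : 0 < ‖x‖ := norm_pos_iff.2 hx
  rw [mem_Icc, Real.le_log_iff_exp_le hn, Real.log_le_iff_le_exp hn]
  rfl

theorem isClosed_annulus (s t : ℝ) : IsClosed (annulus s t) :=
  (isClosed_le continuous_const continuous_norm).inter
    (isClosed_le continuous_norm continuous_const)

theorem integrableOn_annulus (s t : ℝ) :
    IntegrableOn (fun x : Plane => (‖x‖ ^ 2)⁻¹) (annulus s t) := by
  have hc : IsCompact (annulus s t) :=
    (isCompact_closedBall (0 : Plane) (Real.exp t)).of_isClosed_subset (isClosed_annulus s t)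
      fun x hx => mem_closedBall_zero_iff.2 hx.2
  refine ContinuousOn.integrableOn_compact hc ?_
  refine (continuous_norm.pow 2).continuousOn.inv₀ fun x hx => ?_
  exact pow_ne_zero 2 ((Real.exp_pos s).trans_le hx.1).ne'

/-- `∫ |x|⁻²` over an annulus is proportional to its logarithmic width. -/
theorem integral_annulus {s t : ℝ} (hst : s ≤ t) :
    ∫ x in annulus s t, (‖x‖ ^ 2)⁻¹ = 2 * volume.real (Metric.ball (0 : Plane) 1) * (t - s) := by
  set f : ℝ → ℝ := (Icc (Real.exp s) (Real.exp t)).indicator fun y => (y ^ 2)⁻¹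
  have e1 : ∫ x in annulus s t, (‖x‖ ^ 2)⁻¹ = ∫ x : Plane, f ‖x‖ := by
    rw [← integral_indicator (isClosed_annulus s t).measurableSet]
    rfl
  have hsub : Icc (Real.exp s) (Real.exp t) ⊆ Ioi 0 := fun y hy => (Real.exp_pos s).trans_le hy.1
  have e2 : ∫ y in Ioi (0 : ℝ), y ^ (2 - 1) • f y = t - s := by
    have : ∀ y : ℝ, y ^ (2 - 1) • f y =
        (Icc (Real.exp s) (Real.exp t)).indicator (fun y => y⁻¹) y := fun y => by
      by_cases hy : y ∈ Icc (Real.exp s) (Real.exp t)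
      · have hy0 : y ≠ 0 := (hsub hy).ne'
        simp only [f, indicator_of_mem hy, smul_eq_mul]
        field_simp
        exact pow_one y
      · simp only [f, indicator_of_notMem hy, smul_zero]
    simp only [this]
    rw [setIntegral_indicator measurableSet_Icc, inter_eq_right.2 hsub, integral_Icc_eq_integral_Ioc,
      ← intervalIntegral.integral_of_le (Real.exp_le_exp.2 hst),
      integral_inv_of_pos (Real.exp_pos s) (Real.exp_pos t), ← Real.exp_sub, Real.log_exp]
  rw [e1, integral_fun_norm_addHaar volume f, finrank_euclideanSpace_fin, e2]
  simp only [nsmul_eq_mul, smul_eq_mul]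
  push_cast
  ring

theorem norm_sq_eq_integral {Ω : BoundedOpenSet} (u : H10 Ω) :
    ‖u‖ ^ 2 = ∫ x in Ω.carrier, ‖H10.grad Ω u x‖ ^ 2 := by
  rw [← real_inner_self_eq_norm_sq, H10.inner_eq]
  simp only [real_inner_self_eq_norm_sq]

/-- A criterion for `β` to be in the spectrum: on annuli of arbitrarily large logarithmic width
there are pairs of functions whose joint energy is at least that of `m / |x|²`, although the
residual fields are carried by two annuli of logarithmic width `1`. -/
theorem mem_spectrum_of_annular {Ω : BoundedOpenSet} {D : Set Plane} (hD : MeasurableSet D)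
    (hDΩ : D ⊆ Ω.carrier) {β t₁ m C : ℝ} (hm : 0 < m) (hC : 0 ≤ C)
    (hball : Metric.closedBall 0 (Real.exp t₁) ⊆ Ω.carrier)
    (h : ∀ L : ℝ, 0 < L → ∃ u ψ : Fin 2 → H10 Ω,
      (∀ᵐ x ∂volume.restrict Ω.carrier, x ∈ annulus (t₁ - L - 2) (t₁ - 2) →
        m * (‖x‖ ^ 2)⁻¹ ≤ ∑ p, ‖H10.grad Ω (u p) x‖ ^ 2) ∧
      ∀ p, ∀ᵐ x ∂volume.restrict Ω.carrier,
        ‖(D.indicator (fun _ => (1 : ℝ)) x - β) • H10.grad Ω (u p) x -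
          rot (H10.grad Ω (ψ p) x)‖ ^ 2 ≤
        C * ((annulus (t₁ - L - 4) (t₁ - L - 3)).indicator (fun x => (‖x‖ ^ 2)⁻¹) x +
          (annulus (t₁ - 1) t₁).indicator (fun x => (‖x‖ ^ 2)⁻¹) x)) :
    β ∈ spectrum ℝ (poincareOp Ω D) := by
  refine mem_spectrum_of_approx fun ε hε => ?_
  by_contra! hcon
  -- beyond the width `4 C / (ε² m)` the energy exceeds what the residual permits
  set L := 4 * C / (ε ^ 2 * m) + 1
  have hL : 0 < L := by positivity
  obtain ⟨u, ψ, hlow, hup⟩ := h L hL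
  set c₀ := 2 * volume.real (Metric.ball (0 : Plane) 1)
  have hc₀ : 0 < c₀ :=
    mul_pos two_pos (ENNReal.toReal_pos (Metric.measure_ball_pos _ _ one_pos).ne'
      measure_ball_lt_top.ne)
  have hsub : ∀ s t, t ≤ t₁ → annulus s t ⊆ Ω.carrier := fun s t ht x hx =>
    hball (mem_closedBall_zero_iff.2 (hx.2.trans (Real.exp_le_exp.2 ht)))
  have hin : ∀ s t, t ≤ t₁ → Integrable ((annulus s t).indicator fun x : Plane => (‖x‖ ^ 2)⁻¹)
      (volume.restrict Ω.carrier) := fun s t _ =>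
    ((integrable_indicator_iff (isClosed_annulus s t).measurableSet).2
      (integrableOn_annulus s t)).integrableOn
  have hint : ∀ s t, s ≤ t → t ≤ t₁ →
      ∫ x in Ω.carrier, (annulus s t).indicator (fun x : Plane => (‖x‖ ^ 2)⁻¹) x =
        c₀ * (t - s) := fun s t hst ht => by
    rw [setIntegral_indicator (isClosed_annulus s t).measurableSet, inter_eq_right.2 (hsub s t ht),
      integral_annulus hst]
  have hgi : ∀ p, Integrable (fun x => ‖H10.grad Ω (u p) x‖ ^ 2) (volume.restrict Ω.carrier) :=
    fun p => (Lp.memLp (H10.grad Ω (u p))).integrable_norm_pow two_ne_zero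
  have h1 : m * (c₀ * L) ≤ ∑ p, ‖u p‖ ^ 2 := by
    calc m * (c₀ * L) = ∫ x in Ω.carrier, m *
          (annulus (t₁ - L - 2) (t₁ - 2)).indicator (fun x : Plane => (‖x‖ ^ 2)⁻¹) x := by
          rw [integral_const_mul, hint _ _ (by linarith) (by linarith)]
          ring
      _ ≤ ∫ x in Ω.carrier, ∑ p, ‖H10.grad Ω (u p) x‖ ^ 2 := by
          refine integral_mono_ae ((hin _ _ (by linarith)).const_mul m)
            (integrable_finsetSum _ fun p _ => hgi p) ?_
          filter_upwards [hlow] with x hx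
          by_cases hxa : x ∈ annulus (t₁ - L - 2) (t₁ - 2)
          · rw [indicator_of_mem hxa]; exact hx hxa
          · rw [indicator_of_notMem hxa, mul_zero]; positivity
      _ = ∑ p, ‖u p‖ ^ 2 := by
          rw [integral_finsetSum _ fun p _ => hgi p]
          exact Finset.sum_congr rfl fun p _ => (norm_sq_eq_integral (u p)).symm
  have h2 : ∀ p, ε ^ 2 * ‖u p‖ ^ 2 ≤ 2 * C * c₀ := fun p => by
    rw [← mul_pow]
    refine (pow_le_pow_left₀ (by positivity) (hcon (u p)) 2).trans ?_
    refine (norm_poincareOp_sub_sq_le hD hDΩ β (u p) (ψ p)).trans ?_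
    refine (integral_mono_of_nonneg (ae_of_all _ fun x => by positivity)
      (((hin _ _ (by linarith)).add (hin _ _ le_rfl)).const_mul C) (hup p)).trans ?_
    simp only [Pi.add_apply]
    rw [integral_const_mul, integral_add (hin _ _ (by linarith)) (hin _ _ le_rfl),
      hint _ _ (by linarith) (by linarith), hint _ _ (by linarith) le_rfl]
    linarith
  rw [Fin.sum_univ_two] at h1
  have h3 : ε ^ 2 * (m * (c₀ * L)) ≤ 4 * C * c₀ := by
    have := mul_le_mul_of_nonneg_left h1 (sq_nonneg ε)
    linarith [h2 0, h2 1]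
  have h4 : ε ^ 2 * (m * (c₀ * L)) = 4 * C * c₀ + ε ^ 2 * m * c₀ := by
    simp only [L]
    field_simp
  have h5 : 0 < ε ^ 2 * m * c₀ := by positivity
  linarith

/-- Cutoff functions equal to `1` on `[t₀ + 1, t₁ - 1]` and supported in `[t₀, t₁]`, whose derivatives
have a bound that does not depend on the interval. -/
theorem exists_cutoff : ∃ M : ℝ, 0 ≤ M ∧ ∀ t₀ t₁ : ℝ, t₀ + 2 ≤ t₁ →
    ∃ χ χ' : ℝ → ℝ, ContDiff ℝ 1 χ ∧ (∀ t, HasDerivAt χ (χ' t) t) ∧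
      (∀ t, t ≤ t₀ ∨ t₁ ≤ t → χ t = 0) ∧
      (∀ t, t₀ + 1 < t → t < t₁ - 1 → χ t = 1 ∧ χ' t = 0) ∧
      (∀ t, |χ' t| ≤ M) ∧ ∀ t, t ∉ Icc t₀ (t₀ + 1) → t ∉ Icc (t₁ - 1) t₁ → χ' t = 0 := by
  set S := Real.smoothTransition
  have hS : ContDiff ℝ 1 S := Real.smoothTransition.contDiff (n := 1)
  have hSd : ∀ t, HasDerivAt S (deriv S t) t := fun t => (hS.differentiable (by simp) t).hasDerivAt
  have hS0 : ∀ t < 0, deriv S t = 0 := fun t ht => by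
    have : S =ᶠ[𝓝 t] fun _ => 0 := by
      filter_upwards [gt_mem_nhds ht] with y hy
      exact Real.smoothTransition.zero_of_nonpos hy.le
    rw [this.deriv_eq, deriv_const]
  have hS1 : ∀ t, 1 < t → deriv S t = 0 := fun t ht => by
    have : S =ᶠ[𝓝 t] fun _ => 1 := by
      filter_upwards [lt_mem_nhds ht] with y hy
      exact Real.smoothTransition.one_of_one_le hy.le
    rw [this.deriv_eq, deriv_const]
  obtain ⟨B, hB⟩ := isCompact_Icc.exists_bound_of_continuousOn (s := Icc (0 : ℝ) 1)
    (hS.continuous_deriv le_rfl).continuousOn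
  have hB' : ∀ t, |deriv S t| ≤ max B 0 := fun t => by
    by_cases h : t ∈ Icc (0 : ℝ) 1
    · exact (hB t h).trans (le_max_left _ _)
    · have : deriv S t = 0 := by
        by_cases h0 : t < 0
        · exact hS0 t h0
        · exact hS1 t (by by_contra! h1; exact h ⟨not_lt.1 h0, h1⟩)
      rw [this, abs_zero]; exact le_max_right _ _
  have hSn : ∀ t, 0 ≤ S t := Real.smoothTransition.nonneg
  have hSl : ∀ t, S t ≤ 1 := Real.smoothTransition.le_one
  refine ⟨max B 0 + max B 0, by positivity, fun t₀ t₁ h01 => ⟨fun t => S (t - t₀) * S (t₁ - t),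
    fun t => deriv S (t - t₀) * S (t₁ - t) - S (t - t₀) * deriv S (t₁ - t), ?_, fun t => ?_,
    fun t ht => ?_, fun t h1 h2 => ⟨?_, ?_⟩, fun t => ?_, fun t h1 h2 => ?_⟩⟩
  · exact (hS.comp (contDiff_id.sub contDiff_const)).mul
      (hS.comp (contDiff_const.sub contDiff_id))
  · have e1 := (hSd (t - t₀)).comp t ((hasDerivAt_id t).sub_const t₀)
    have e2 := (hSd (t₁ - t)).comp t ((hasDerivAt_id t).const_sub t₁)
    refine (e1.mul e2).congr_deriv ?_
    simp only [Function.comp_apply, id_eq]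
    ring
  · rcases ht with h | h
    · change S (t - t₀) * _ = 0
      rw [show S (t - t₀) = 0 from Real.smoothTransition.zero_of_nonpos (by linarith), zero_mul]
    · change _ * S (t₁ - t) = 0
      rw [show S (t₁ - t) = 0 from Real.smoothTransition.zero_of_nonpos (by linarith), mul_zero]
  · change S (t - t₀) * S (t₁ - t) = 1
    rw [show S (t - t₀) = 1 from Real.smoothTransition.one_of_one_le (by linarith),
      show S (t₁ - t) = 1 from Real.smoothTransition.one_of_one_le (by linarith), one_mul]
  · change deriv S (t - t₀) * S (t₁ - t) - S (t - t₀) * deriv S (t₁ - t) = 0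
    rw [hS1 _ (by linarith), hS1 _ (by linarith), zero_mul, mul_zero, sub_zero]
  · refine (abs_sub _ _).trans (add_le_add ?_ ?_)
    · rw [abs_mul, abs_of_nonneg (hSn (t₁ - t))]
      exact (mul_le_of_le_one_right (abs_nonneg _) (hSl _)).trans (hB' _)
    · rw [abs_mul, abs_of_nonneg (hSn (t - t₀))]
      exact (mul_le_of_le_one_left (abs_nonneg _) (hSl _)).trans (hB' _)
  · change deriv S (t - t₀) * S (t₁ - t) - S (t - t₀) * deriv S (t₁ - t) = 0
    have d0 : deriv S (t - t₀) = 0 := by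
      by_cases h : t < t₀
      · exact hS0 _ (by linarith)
      · refine hS1 _ ?_
        by_contra! h'
        exact h1 ⟨not_lt.1 h, by linarith⟩
    have d1 : deriv S (t₁ - t) = 0 := by
      by_cases h : t₁ < t
      · exact hS0 _ (by linarith)
      · refine hS1 _ ?_
        by_contra! h'
        exact h2 ⟨by linarith, not_lt.1 h⟩
    rw [d0, d1, zero_mul, mul_zero, sub_zero]

/-- The boundary of a double sector is a null set, being contained in two lines. -/
theorem volume_cone_eq_zero {a : ℝ} (ha : 0 < Real.cos a) :
    volume {x : Plane | |x 1| = Real.sin a * ‖x‖} = 0 := by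
  have hline : ∀ σ : ℝ, volume {x : Plane | x 1 * Real.cos a = σ * x 0} = 0 := fun σ => by
    let f : Plane →ₗ[ℝ] ℝ :=
      { toFun := fun x => x 1 * Real.cos a - σ * x 0
        map_add' := fun x y => by simp; ring
        map_smul' := fun c x => by simp; ring }
    have hf : LinearMap.ker f ≠ ⊤ := fun h => by
      have : !₂[(0 : ℝ), 1] ∈ LinearMap.ker f := by rw [h]; trivial
      have h2 : (1 : ℝ) * Real.cos a - σ * 0 = 0 := this
      linarith
    have e : {x : Plane | x 1 * Real.cos a = σ * x 0} = (LinearMap.ker f : Set Plane) := by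
      ext x
      exact sub_eq_zero.symm
    rw [e]
    exact Measure.addHaar_submodule volume _ hf
  refine measure_mono_null ?_ (measure_union_null (hline (Real.sin a)) (hline (-Real.sin a)))
  intro x hx
  have h1 : x 1 ^ 2 = Real.sin a ^ 2 * (x 0 ^ 2 + x 1 ^ 2) := by
    rw [← plane_norm_sq, ← mul_pow, ← sq_abs, show |x 1| = _ from hx]
  have h2 := Real.sin_sq_add_cos_sq a
  have h3 : (x 1 * Real.cos a) ^ 2 = (Real.sin a * x 0) ^ 2 := by
    have : Real.cos a ^ 2 = 1 - Real.sin a ^ 2 := by linarith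
    rw [mul_pow, this]; linarith
  rcases sq_eq_sq_iff_eq_or_eq_neg.1 h3 with h | h
  · exact Or.inl h
  · right; change x 1 * Real.cos a = -Real.sin a * x 0; rw [h]; ring

/-! ### The spectrum of the bowtie -/

theorem grad_smul_ae {Ω : BoundedOpenSet} (c : ℝ) (w : H10 Ω) :
    ∀ᵐ x ∂volume.restrict Ω.carrier, H10.grad Ω (c • w) x = c • H10.grad Ω w x := by
  rw [map_smul]
  exact Lp.coeFn_smul c (H10.grad Ω w)

theorem rot_rad_add_ang (x : Plane) (p q : ℝ) :
    rot (p • rad x + q • ang x) = p • ang x - q • rad x := by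
  rw [map_add, map_smul, map_smul, ang, rot_rot, smul_neg, sub_eq_add_neg]

/-- Localized versions of the two waves, with phase `p π / 2` in `t = log |x|`. Here `χ` and `χ'` are
the values of the cutoff and its derivative at `t`, `C` and `S` those of the cosine and sine factors,
and `c` is the coefficient `1_D - β` wherever the waves do not vanish. Two phases are needed because
the energy density of a single wave degenerates for some `t`, whereas `cos² + sin² = 1`. -/
theorem exists_localized_waves {Ω : BoundedOpenSet} {D : Set Plane} {r₀ a γ η β t₁ : ℝ}
    (ha : 0 < a) (hγ : 0 < γ) (haγ : a + γ = Real.pi / 2)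
    (hsec : ∀ x : Plane, x ≠ 0 → ‖x‖ < r₀ → (x ∈ D ↔ |x 1| < Real.sin a * ‖x‖))
    (ht₁ : Real.exp t₁ < r₀) (hball : Metric.closedBall 0 (Real.exp t₁) ⊆ Ω.carrier)
    (hη : 0 < η) (hdisp : (1 - β) * (Real.sinh (η * a) * Real.sinh (η * γ)) =
      β * (Real.cosh (η * a) * Real.cosh (η * γ))) :
    ∃ m M B : ℝ, 0 < m ∧ 0 ≤ M ∧ 0 ≤ B ∧ ∀ L : ℝ, 0 < L → ∃ w v : Fin 2 → H10 Ω,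
      ∀ᵐ x ∂volume.restrict Ω.carrier, ∃ g g' χ χ' c : ℝ,
        m ≤ g ^ 2 + g' ^ 2 ∧ g ^ 2 + g' ^ 2 ≤ M ∧ |χ'| ≤ B ∧ (c = 1 - β ∨ c = -β) ∧
        (x ∈ annulus (t₁ - L - 2) (t₁ - 2) → χ = 1 ∧ χ' = 0) ∧
        (x ∉ annulus (t₁ - L - 4) (t₁ - L - 3) → x ∉ annulus (t₁ - 1) t₁ → χ' = 0) ∧
        (c = D.indicator (fun _ => (1 : ℝ)) x - β ∨ χ = 0 ∧ χ' = 0) ∧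
        ∀ p : Fin 2, ∃ C S : ℝ, C ^ 2 + S ^ 2 = 1 ∧
          (C = if p = 0 then Real.cos (η * Real.log ‖x‖) else -Real.sin (η * Real.log ‖x‖)) ∧
          H10.grad Ω (w p) x =
            ((χ' * C - η * χ * S) * g) • rad x + (χ * C * g') • ang x ∧
          H10.grad Ω (v p) x =
            c • (((χ' * S + η * χ * C) * g' / η) • rad x + (χ * S * η * g) • ang x) := by
  have ha' : a < Real.pi / 2 := by linarith
  have hγ' : γ < Real.pi / 2 := by linarith
  obtain ⟨m, M, hm, hM, hgrad⟩ := exists_wave_gradients ha hγ haγ hη hdisp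
  obtain ⟨B, hB, hcut⟩ := exists_cutoff
  refine ⟨m, M, B, hm, hM, hB, fun L hL => ?_⟩
  obtain ⟨χ, χ', hχ, hχd, hχ0, hχ1, hχB, hχs⟩ := hcut (t₁ - L - 4) t₁ (by linarith)
  set ϕ : Fin 2 → ℝ := fun p => if p = 0 then 0 else Real.pi / 2
  set k : Fin 2 → ℝ → ℝ := fun p t => χ t * Real.cos (η * t + ϕ p)
  set l : Fin 2 → ℝ → ℝ := fun p t => χ t * Real.sin (η * t + ϕ p)
  have hkd : ∀ p t, HasDerivAt (k p)
      (χ' t * Real.cos (η * t + ϕ p) - η * χ t * Real.sin (η * t + ϕ p)) t := fun p t => by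
    have h1 : HasDerivAt (fun t => η * t + ϕ p) η t := by
      simpa using ((hasDerivAt_id t).const_mul η).add_const (ϕ p)
    refine ((hχd t).mul h1.cos).congr_deriv ?_
    ring
  have hld : ∀ p t, HasDerivAt (l p)
      (χ' t * Real.sin (η * t + ϕ p) + η * χ t * Real.cos (η * t + ϕ p)) t := fun p t => by
    have h1 : HasDerivAt (fun t => η * t + ϕ p) η t := by
      simpa using ((hasDerivAt_id t).const_mul η).add_const (ϕ p)
    refine ((hχd t).mul h1.sin).congr_deriv ?_
    ring
  have hw : ∀ p, ∃ w : H10 Ω,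
      H10.grad Ω w =ᵐ[volume.restrict Ω.carrier] ∇ (wave η 1 0 a γ (k p)) := fun p =>
    exists_grad_eq_wave (t₀ := t₁ - L - 4) (hχ.mul (by fun_prop)) (fun t ht => by simp [k, hχ0 t ht]) ha ha' hγ hγ'
      hball
  have hv : ∀ p, ∃ v : H10 Ω,
      H10.grad Ω v =ᵐ[volume.restrict Ω.carrier] ∇ (wave η 0 1 γ a (l p)) := fun p =>
    exists_grad_eq_wave (t₀ := t₁ - L - 4) (hχ.mul (by fun_prop)) (fun t ht => by simp [l, hχ0 t ht]) hγ hγ' ha ha'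
      hball
  choose w hw using hw
  choose v hv using hv
  set κ := (1 - β) * (Real.sinh (η * a) / Real.cosh (η * a))
  refine ⟨w, fun p => κ • v p, ?_⟩
  have hcos : 0 < Real.cos a := Real.cos_pos_of_mem_Ioo ⟨by linarith, ha'⟩
  filter_upwards [ae_all_iff.2 hw, ae_all_iff.2 hv, ae_all_iff.2 fun p => grad_smul_ae κ (v p),
    ae_restrict_of_ae (measure_eq_zero_iff_ae_notMem.1 (volume_cone_eq_zero hcos)),
    ae_restrict_of_ae (measure_eq_zero_iff_ae_notMem.1
      (measure_singleton (0 : Plane) (μ := volume)))] with x hxw hxv hxκ hcone hx0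
  have hx : x ≠ 0 := hx0
  obtain ⟨g, g', hg1, hg2, hgr⟩ := hgrad x hx hcone
  set t := Real.log ‖x‖ with ht
  refine ⟨g, g', χ t, χ' t, if |x 1| < Real.sin a * ‖x‖ then 1 - β else -β, hg1, hg2, hχB t,
    ?_, fun hxa => ?_, fun h1 h2 => ?_, ?_, fun p => ⟨Real.cos (η * t + ϕ p),
      Real.sin (η * t + ϕ p), Real.cos_sq_add_sin_sq _, ?_, ?_, ?_⟩⟩
  · split_ifs <;> simp
  · rw [mem_annulus_iff hx, mem_Icc] at hxa
    exact hχ1 t (by linarith) (by linarith)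
  · rw [mem_annulus_iff hx] at h1 h2
    refine hχs t (fun h => h1 ?_) h2
    exact ⟨h.1, by linarith [h.2]⟩
  · by_cases hr : ‖x‖ < r₀
    · left
      by_cases hxD : x ∈ D
      · rw [if_pos ((hsec x hx hr).1 hxD), indicator_of_mem hxD]
      · rw [if_neg (fun h => hxD ((hsec x hx hr).2 h)), indicator_of_notMem hxD, zero_sub]
    · right
      have h1 : t₁ < t :=
        (Real.lt_log_iff_exp_lt (norm_pos_iff.2 hx)).2 (ht₁.trans_le (not_lt.1 hr))
      refine ⟨hχ0 t (Or.inr h1.le), hχs t (fun h => ?_) fun h => ?_⟩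
      · linarith [h.2]
      · linarith [h.2]
  · simp only [ϕ]
    split_ifs
    · rw [add_zero]
    · rw [Real.cos_add_pi_div_two]
  · rw [hxw p, (hgr (k p) (l p) _ _ (hkd p t) (hld p t)).1]
  · rw [hxκ p, hxv p, (hgr (k p) (l p) _ _ (hkd p t) (hld p t)).2]

/-- The energy density of the flux mismatch is controlled by `|x|⁻²`. -/
theorem mismatch_le {M B η : ℝ} (hη : 0 < η) {x : Plane} {g g' χ' C S s s' A : ℝ}
    (hA : |A| ≤ 1) (hg : g ^ 2 + g' ^ 2 ≤ M) (hχ' : |χ'| ≤ B) (hCS : C ^ 2 + S ^ 2 = 1)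
    (hs : s = χ' * C * g) (hs' : s' = χ' * S * g' / η) :
    A ^ 2 * (s ^ 2 + s' ^ 2) * (‖x‖ ^ 2)⁻¹ ≤
      B ^ 2 * ((1 + 1 / η ^ 2) * M) * (‖x‖ ^ 2)⁻¹ := by
  refine mul_le_mul_of_nonneg_right ?_ (by positivity)
  have h1 : A ^ 2 ≤ 1 := (sq_le_one_iff_abs_le_one A).2 hA
  have h2 : χ' ^ 2 ≤ B ^ 2 := by rw [← sq_abs]; exact pow_le_pow_left₀ (abs_nonneg _) hχ' 2
  have h3 : C ^ 2 ≤ 1 := by nlinarith [sq_nonneg S]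
  have h4 : S ^ 2 ≤ 1 := by nlinarith [sq_nonneg C]
  have h5 : s ^ 2 + s' ^ 2 = χ' ^ 2 * (C ^ 2 * g ^ 2 + 1 / η ^ 2 * (S ^ 2 * g' ^ 2)) := by
    rw [hs, hs']; field_simp
  have h6 : C ^ 2 * g ^ 2 + 1 / η ^ 2 * (S ^ 2 * g' ^ 2) ≤ (1 + 1 / η ^ 2) * M := by
    have e1 : C ^ 2 * g ^ 2 ≤ M :=
      (mul_le_of_le_one_left (sq_nonneg g) h3).trans (by linarith [sq_nonneg g'])
    have e2 : S ^ 2 * g' ^ 2 ≤ M :=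
      (mul_le_of_le_one_left (sq_nonneg g') h4).trans (by linarith [sq_nonneg g])
    rw [add_mul, one_mul]
    exact add_le_add e1 (mul_le_mul_of_nonneg_left e2 (by positivity))
  have h7 : s ^ 2 + s' ^ 2 ≤ B ^ 2 * ((1 + 1 / η ^ 2) * M) := by
    rw [h5]
    exact mul_le_mul h2 h6 (by positivity) (by positivity)
  exact (mul_le_of_le_one_left (by positivity) h1).trans h7

theorem le_indicator_annuli {K : ℝ} (hK : 0 ≤ K) {s t s' t' : ℝ} {x : Plane} {y : ℝ}
    (hy : y ≤ K * (‖x‖ ^ 2)⁻¹) (h0 : x ∉ annulus s t → x ∉ annulus s' t' → y = 0) :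
    y ≤ K * ((annulus s t).indicator (fun x => (‖x‖ ^ 2)⁻¹) x +
      (annulus s' t').indicator (fun x => (‖x‖ ^ 2)⁻¹) x) := by
  have hn : 0 ≤ (‖x‖ ^ 2)⁻¹ := by positivity
  by_cases h1 : x ∈ annulus s t
  · rw [indicator_of_mem h1]
    refine hy.trans (mul_le_mul_of_nonneg_left (le_add_of_nonneg_right ?_) hK)
    exact indicator_nonneg (fun _ _ => by positivity) _
  · by_cases h2 : x ∈ annulus s' t'
    · rw [indicator_of_mem h2]
      refine hy.trans (mul_le_mul_of_nonneg_left (le_add_of_nonneg_left ?_) hK)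
      exact indicator_nonneg (fun _ _ => by positivity) _
    · rw [h0 h1 h2, indicator_of_notMem h1, indicator_of_notMem h2, add_zero, mul_zero]

theorem abs_coefficient_le {β c : ℝ} (hβ0 : 0 < β) (hβ : β < 1 / 2) (hc : c = 1 - β ∨ c = -β) :
    |c| ≤ 1 ∧ β ^ 2 ≤ c ^ 2 := by
  rcases hc with rfl | rfl
  · exact ⟨abs_le.2 ⟨by linarith, by linarith⟩, by nlinarith⟩
  · exact ⟨abs_le.2 ⟨by linarith, by linarith⟩, by rw [neg_sq]⟩

/-- A solution of the dispersion relation is a spectral value, the localized first waves being a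
singular sequence. -/
theorem mem_spectrum_of_dispersion {Ω : BoundedOpenSet} {D : Set Plane} (hD : MeasurableSet D)
    (hDΩ : D ⊆ Ω.carrier) {r₀ a γ η β t₁ : ℝ}
    (ha : 0 < a) (hγ : 0 < γ) (haγ : a + γ = Real.pi / 2)
    (hsec : ∀ x : Plane, x ≠ 0 → ‖x‖ < r₀ → (x ∈ D ↔ |x 1| < Real.sin a * ‖x‖))
    (ht₁ : Real.exp t₁ < r₀) (hball : Metric.closedBall 0 (Real.exp t₁) ⊆ Ω.carrier)
    (hβ0 : 0 < β) (hβ : β < 1 / 2)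
    (hη : 0 < η) (hdisp : (1 - β) * (Real.sinh (η * a) * Real.sinh (η * γ)) =
      β * (Real.cosh (η * a) * Real.cosh (η * γ))) :
    β ∈ spectrum ℝ (poincareOp Ω D) := by
  obtain ⟨m, M, B, hm, hM, hB, hwav⟩ := exists_localized_waves ha hγ haγ hsec ht₁ hball hη hdisp
  set ν := min 1 (η ^ 2)
  have hν : 0 < ν := by positivity
  have hν1 : ν ≤ 1 := min_le_left _ _
  have hν2 : ν ≤ η ^ 2 := min_le_right _ _
  have hK : 0 ≤ B ^ 2 * ((1 + 1 / η ^ 2) * M) := by positivity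
  refine mem_spectrum_of_annular hD hDΩ (m := ν * m) (by positivity) hK hball fun L hL => ?_
  obtain ⟨w, v, hwv⟩ := hwav L hL
  refine ⟨w, v, ?_, fun p => ?_⟩
  · filter_upwards [hwv] with x hx hxa
    obtain ⟨g, g', χ, χ', c, hg1, hg2, hχB, hc, hin, hout, hD', hp⟩ := hx
    obtain ⟨rfl, rfl⟩ := hin hxa
    obtain ⟨C0, S0, h0, hC0, hw0, -⟩ := hp 0
    obtain ⟨C1, S1, h1, hC1, hw1, -⟩ := hp 1
    have hCC : C0 ^ 2 + C1 ^ 2 = 1 := by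
      rw [hC0, hC1]
      simp
    rw [Fin.sum_univ_two, hw0, hw1, norm_sq_rad_add_ang, norm_sq_rad_add_ang, ← add_mul]
    refine mul_le_mul_of_nonneg_right ?_ (by positivity)
    have e : ((0 * C0 - η * 1 * S0) * g) ^ 2 + (1 * C0 * g') ^ 2 +
        (((0 * C1 - η * 1 * S1) * g) ^ 2 + (1 * C1 * g') ^ 2) = η ^ 2 * g ^ 2 + g' ^ 2 := by
      linear_combination (-η ^ 2 * g ^ 2 + g' ^ 2) * hCC + η ^ 2 * g ^ 2 * h0 +
        η ^ 2 * g ^ 2 * h1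
    rw [e]
    nlinarith [sq_nonneg g, sq_nonneg g']
  · filter_upwards [hwv] with x hx
    obtain ⟨g, g', χ, χ', c, hg1, hg2, hχB, hc, hin, hout, hD', hp⟩ := hx
    obtain ⟨C, S, hCS, -, hw, hv⟩ := hp p
    have e : (D.indicator (fun _ => (1 : ℝ)) x - β) • H10.grad Ω (w p) x -
        rot (H10.grad Ω (v p) x) =
        (c * (χ' * C * g)) • rad x + (c * -(χ' * S * g' / η)) • ang x := by
      have h1 : (D.indicator (fun _ => (1 : ℝ)) x - β) • H10.grad Ω (w p) x =
          c • H10.grad Ω (w p) x := by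
        rcases hD' with h | ⟨rfl, rfl⟩
        · rw [h]
        · rw [hw]; simp
      rw [h1, hw, hv, map_smul, rot_rad_add_ang]
      match_scalars <;> field_simp <;> ring
    have hb := mismatch_le hη (x := x) (abs_coefficient_le hβ0 hβ hc).1 hg2 hχB hCS rfl rfl
    rw [e, norm_sq_rad_add_ang]
    refine le_indicator_annuli hK (le_of_eq_of_le ?_ hb) fun h1 h2 => ?_
    · ring
    · rw [hout h1 h2]; ring

/-- The second waves are a singular sequence for `1 - β`, because
`(1_D - (1 - β)) (1_D - β) = β (1 - β)`. -/
theorem one_sub_mem_spectrum_of_dispersion {Ω : BoundedOpenSet} {D : Set Plane} (hD : MeasurableSet D)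
    (hDΩ : D ⊆ Ω.carrier) {r₀ a γ η β t₁ : ℝ}
    (ha : 0 < a) (hγ : 0 < γ) (haγ : a + γ = Real.pi / 2)
    (hsec : ∀ x : Plane, x ≠ 0 → ‖x‖ < r₀ → (x ∈ D ↔ |x 1| < Real.sin a * ‖x‖))
    (ht₁ : Real.exp t₁ < r₀) (hball : Metric.closedBall 0 (Real.exp t₁) ⊆ Ω.carrier)
    (hβ0 : 0 < β) (hβ : β < 1 / 2)
    (hη : 0 < η) (hdisp : (1 - β) * (Real.sinh (η * a) * Real.sinh (η * γ)) =
      β * (Real.cosh (η * a) * Real.cosh (η * γ))) :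
    1 - β ∈ spectrum ℝ (poincareOp Ω D) := by
  obtain ⟨m, M, B, hm, hM, hB, hwav⟩ := exists_localized_waves ha hγ haγ hsec ht₁ hball hη hdisp
  set ν := min 1 (η ^ 2)
  have hν : 0 < ν := by positivity
  have hν1 : ν ≤ 1 := min_le_left _ _
  have hν2 : ν ≤ η ^ 2 := min_le_right _ _
  have hK : 0 ≤ B ^ 2 * ((1 + 1 / η ^ 2) * M) := by positivity
  refine mem_spectrum_of_annular hD hDΩ (m := β ^ 2 * (ν * m)) (by positivity) hK hball
    fun L hL => ?_
  obtain ⟨w, v, hwv⟩ := hwav L hL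
  refine ⟨v, fun p => (-(β * (1 - β))) • w p, ?_, fun p => ?_⟩
  · filter_upwards [hwv] with x hx hxa
    obtain ⟨g, g', χ, χ', c, hg1, hg2, hχB, hc, hin, hout, hD', hp⟩ := hx
    obtain ⟨rfl, rfl⟩ := hin hxa
    obtain ⟨C0, S0, h0, hC0, -, hv0⟩ := hp 0
    obtain ⟨C1, S1, h1, hC1, -, hv1⟩ := hp 1
    have hCC : C0 ^ 2 + C1 ^ 2 = 1 := by
      rw [hC0, hC1]
      simp
    rw [Fin.sum_univ_two, hv0, hv1, norm_smul, norm_smul, mul_pow, mul_pow, norm_sq_rad_add_ang,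
      norm_sq_rad_add_ang, ← mul_add, ← add_mul, ← mul_assoc (‖c‖ ^ 2), Real.norm_eq_abs, sq_abs]
    refine mul_le_mul_of_nonneg_right ?_ (by positivity)
    have e : ((0 * S0 + η * 1 * C0) * g' / η) ^ 2 + (1 * S0 * η * g) ^ 2 +
        (((0 * S1 + η * 1 * C1) * g' / η) ^ 2 + (1 * S1 * η * g) ^ 2) =
        η ^ 2 * g ^ 2 + g' ^ 2 := by
      have d : ∀ C S : ℝ, ((0 : ℝ) * S + η * 1 * C) * g' / η = C * g' := fun C S => by field_simp; ring
      rw [d, d]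
      linear_combination (-η ^ 2 * g ^ 2 + g' ^ 2) * hCC + η ^ 2 * g ^ 2 * h0 +
        η ^ 2 * g ^ 2 * h1
    rw [e]
    refine mul_le_mul (abs_coefficient_le hβ0 hβ hc).2 ?_ (by positivity) (sq_nonneg _)
    nlinarith [sq_nonneg g, sq_nonneg g']
  · filter_upwards [hwv, grad_smul_ae (-(β * (1 - β))) (w p)] with x hx hs
    obtain ⟨g, g', χ, χ', c, hg1, hg2, hχB, hc, hin, hout, hD', hp⟩ := hx
    obtain ⟨C, S, hCS, -, hw, hv⟩ := hp p
    have e : (D.indicator (fun _ => (1 : ℝ)) x - (1 - β)) • H10.grad Ω (v p) x -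
        rot (H10.grad Ω ((-(β * (1 - β))) • w p) x) =
        (β * (1 - β) * (χ' * S * g' / η)) • rad x + (β * (1 - β) * (χ' * C * g)) • ang x := by
      have h1 : (D.indicator (fun _ => (1 : ℝ)) x - (1 - β)) • H10.grad Ω (v p) x =
          (β * (1 - β)) • (((χ' * S + η * χ * C) * g' / η) • rad x +
            (χ * S * η * g) • ang x) := by
        rcases hD' with h | ⟨rfl, rfl⟩
        · rw [hv, smul_smul]
          congr 1
          have hi : D.indicator (fun _ => (1 : ℝ)) x = c + β := by linarith
          rw [hi]
          rcases hc with rfl | rfl <;> ring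
        · rw [hv]; simp
      rw [h1, hs, hw, map_smul, rot_rad_add_ang]
      match_scalars <;> field_simp <;> ring
    have hA : |β * (1 - β)| ≤ 1 := by
      rw [abs_of_pos (mul_pos hβ0 (by linarith))]
      nlinarith
    have hb := mismatch_le hη (x := x) hA hg2 hχB hCS rfl rfl
    rw [e, norm_sq_rad_add_ang]
    refine le_indicator_annuli hK (le_of_eq_of_le ?_ hb) fun h1 h2 => ?_
    · ring
    · rw [hout h1 h2]; ring

theorem abs_sin_lt_sin {a θ : ℝ} (ha : a < Real.pi / 2) (hθ : |θ| < a) :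
    |Real.sin θ| < Real.sin a := by
  rw [abs_lt] at hθ ⊢
  rw [← Real.sin_neg]
  exact ⟨Real.sin_lt_sin_of_lt_of_le_pi_div_two (by linarith) (by linarith) hθ.1,
    Real.sin_lt_sin_of_lt_of_le_pi_div_two (by linarith) ha.le hθ.2⟩

theorem norm_polar {r : ℝ} (hr : 0 < r) (θ : ℝ) :
    ‖(!₂[r * Real.cos θ, r * Real.sin θ] : Plane)‖ = r := by
  rw [← abs_of_nonneg (norm_nonneg _), ← abs_of_pos hr, ← sq_eq_sq_iff_abs_eq_abs, plane_norm_sq,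
    abs_of_pos hr]
  simp only [Matrix.cons_val_zero, Matrix.cons_val_one]
  linear_combination r ^ 2 * Real.sin_sq_add_cos_sq θ

/-- Near the vertex the bowtie is the double sector `|x₂| < sin (α / 2) |x|`. -/
theorem IsBowtie.mem_iff {r₀ α : ℝ} {D₁ D₂ : Set Plane} (hD : IsBowtie r₀ α D₁ D₂) {x : Plane}
    (hx : x ≠ 0) (hr : ‖x‖ < r₀) : x ∈ D₁ ∪ D₂ ↔ |x 1| < Real.sin (α / 2) * ‖x‖ := by
  have hα0 := hD.α_pos
  have hα := hD.α_lt
  have hn : 0 < ‖x‖ := norm_pos_iff.2 hx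
  have hb : x ∈ Metric.ball (0 : Plane) r₀ := mem_ball_zero_iff.2 hr
  have h1 : x ∈ D₁ ↔ x ∈ sector r₀ α 0 := by
    rw [← hD.sector₁]; exact ⟨fun h => ⟨h, hb⟩, fun h => h.1⟩
  have h2 : x ∈ D₂ ↔ x ∈ sector r₀ α Real.pi := by
    rw [← hD.sector₂]; exact ⟨fun h => ⟨h, hb⟩, fun h => h.1⟩
  rw [mem_union, h1, h2]
  constructor
  · have key : ∀ r θ φ : ℝ, 0 < r → |φ| < α / 2 → |Real.sin θ| = |Real.sin φ| →
        x = !₂[r * Real.cos θ, r * Real.sin θ] → |x 1| < Real.sin (α / 2) * ‖x‖ := by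
      intro r θ φ hr0 hφ hs hxe
      have e1 : x 1 = r * Real.sin θ := by rw [hxe]; rfl
      have e2 : ‖x‖ = r := by rw [hxe, norm_polar hr0]
      rw [e1, e2, abs_mul, abs_of_pos hr0, hs, mul_comm]
      exact mul_lt_mul_of_pos_right (abs_sin_lt_sin (by linarith) hφ) hr0
    rintro (⟨r, θ, hr0, -, hl, hu, hxe⟩ | ⟨r, θ, hr0, -, hl, hu, hxe⟩)
    · exact key r θ θ hr0 (abs_lt.2 ⟨by linarith, by linarith⟩) rfl hxe
    · refine key r θ (θ - Real.pi) hr0 (abs_lt.2 ⟨by linarith, by linarith⟩) ?_ hxe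
      rw [Real.sin_sub_pi, abs_neg]
  · intro h
    set q := x 1 / ‖x‖
    have hq : |q| < Real.sin (α / 2) := by rwa [abs_div, abs_of_pos hn, div_lt_iff₀ hn]
    have hs1 := Real.sin_le_one (α / 2)
    have hq' := abs_lt.1 hq
    have hx1 : ‖x‖ * q = x 1 := mul_div_cancel₀ _ hn.ne'
    have hsin : Real.sin (Real.arcsin q) = q := Real.sin_arcsin (by linarith) (by linarith)
    have hcos : ‖x‖ * Real.cos (Real.arcsin q) = |x 0| := by
      have h3 : ‖x‖ ^ 2 * (1 - q ^ 2) = x 0 ^ 2 := by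
        rw [mul_sub, mul_one, ← mul_pow, hx1, plane_norm_sq]; ring
      rw [Real.cos_arcsin, ← Real.sqrt_sq_eq_abs, ← h3, Real.sqrt_mul (sq_nonneg _),
        Real.sqrt_sq hn.le]
    have harc : Real.arcsin (Real.sin (α / 2)) = α / 2 :=
      Real.arcsin_sin (by linarith) (by linarith)
    have hmem : Real.sin (α / 2) ∈ Icc (-1 : ℝ) 1 := ⟨by linarith [abs_nonneg q], hs1⟩
    have hqm : q ∈ Icc (-1 : ℝ) 1 := ⟨by linarith, by linarith⟩
    have hu : Real.arcsin q < α / 2 := by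
      rw [← harc]; exact Real.strictMonoOn_arcsin hqm hmem hq'.2
    have hl : -(α / 2) < Real.arcsin q := by
      rw [← harc, ← Real.arcsin_neg]
      exact Real.strictMonoOn_arcsin ⟨by linarith, by linarith⟩ hqm hq'.1
    rcases le_total 0 (x 0) with h0 | h0
    · refine Or.inl ⟨‖x‖, Real.arcsin q, hn, hr, by linarith, by linarith, ?_⟩
      rw [hcos, hsin, hx1, abs_of_nonneg h0]
      ext i; fin_cases i <;> rfl
    · refine Or.inr ⟨‖x‖, Real.pi - Real.arcsin q, hn, hr, by linarith, by linarith, ?_⟩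
      rw [Real.cos_pi_sub, Real.sin_pi_sub, mul_neg, hcos, hsin, hx1, abs_of_nonpos h0, neg_neg]
      ext i; fin_cases i <;> rfl

/-- The two families `β` and `1 - β` with `0 < β < 1/2` are dense in `[0, 1]`. -/
theorem Icc_subset_of_isClosed {S : Set ℝ} (hS : IsClosed S)
    (h : ∀ β, 0 < β → β < 1 / 2 → β ∈ S ∧ 1 - β ∈ S) : Icc 0 1 ⊆ S := by
  have hlow : Icc (0 : ℝ) (1 / 2) ⊆ S := by
    rw [← closure_Ioo (by norm_num)]
    exact closure_minimal (fun β hβ => (h β hβ.1 hβ.2).1) hS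
  have hup : Icc (1 / 2 : ℝ) 1 ⊆ S := by
    rw [← closure_Ioo (by norm_num)]
    refine closure_minimal (fun β hβ => ?_) hS
    have := (h (1 - β) (by linarith [hβ.2]) (by linarith [hβ.1])).2
    rwa [sub_sub_cancel] at this
  intro β hβ
  rcases le_total β (1 / 2) with h | h
  · exact hlow ⟨hβ.1, h⟩
  · exact hup ⟨h, hβ.2⟩

theorem spectrum_bowtie {Ω : BoundedOpenSet} (h0 : (0 : Plane) ∈ Ω.carrier) {r₀ α : ℝ}
    {D₁ D₂ : Set Plane} (hD : IsBowtie r₀ α D₁ D₂) (hDΩ : D₁ ∪ D₂ ⊆ Ω.carrier) :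
    spectrum ℝ (poincareOp Ω (D₁ ∪ D₂)) = Icc 0 1 := by
  refine (spectrum_poincareOp_subset Ω _).antisymm
    (Icc_subset_of_isClosed (isClosed_spectrum _) fun β hβ0 hβ => ?_)
  have hm : MeasurableSet (D₁ ∪ D₂) := (hD.isOpen₁.union hD.isOpen₂).measurableSet
  obtain ⟨ρ, hρ, hρΩ⟩ := Metric.isOpen_iff.1 Ω.isOpen 0 h0
  obtain ⟨t₁, ht₁⟩ : ∃ t₁, Real.exp t₁ = min ρ r₀ / 2 :=
    ⟨_, Real.exp_log (half_pos (lt_min hρ hD.r₀_pos))⟩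
  have hr : 0 < min ρ r₀ := lt_min hρ hD.r₀_pos
  have htr : Real.exp t₁ < r₀ := by linarith [min_le_right ρ r₀]
  have hball : Metric.closedBall 0 (Real.exp t₁) ⊆ Ω.carrier :=
    (Metric.closedBall_subset_ball (by linarith [min_le_left ρ r₀])).trans hρΩ
  have ha : 0 < α / 2 := half_pos hD.α_pos
  have hγ : 0 < Real.pi / 2 - α / 2 := by linarith [hD.α_lt]
  obtain ⟨η, hη, hdisp⟩ := exists_dispersion ha hγ hβ0 hβ
  exact ⟨mem_spectrum_of_dispersion hm hDΩ ha hγ (add_sub_cancel _ _)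
      (fun x hx hr => hD.mem_iff hx hr) htr hball hβ0 hβ hη hdisp,
    one_sub_mem_spectrum_of_dispersion hm hDΩ ha hγ (add_sub_cancel _ _)
      (fun x hx hr => hD.mem_iff hx hr) htr hball hβ0 hβ hη hdisp⟩

end Bowtie

end

theorem corollary5p3 (Ω : Bowtie.BoundedOpenSet) (h0 : (0 : Bowtie.Plane) ∈ Ω.carrier)
    (hΩ : ∀ p ∈ frontier Ω.carrier, Bowtie.SmoothBoundaryAt Ω.carrier p)
    (r₀ α : ℝ) (D₁ D₂ : Set Bowtie.Plane) (hD : Bowtie.IsBowtie r₀ α D₁ D₂)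
    (hDΩ : closure (D₁ ∪ D₂) ⊆ Ω.carrier) :
    Bowtie.limitSpectrum Ω D₁ D₂ = spectrum ℝ (Bowtie.poincareOp Ω (D₁ ∪ D₂)) ∧
      spectrum ℝ (Bowtie.poincareOp Ω (D₁ ∪ D₂)) = Set.Icc (0 : ℝ) 1 := by
  have hσ := Bowtie.spectrum_bowtie h0 hD (subset_closure.trans hDΩ)
  refine ⟨Set.Subset.antisymm ?_
    (Bowtie.spectrum_subset_limitSpectrum hD.isOpen₁ hD.isOpen₂ hDΩ), hσ⟩
  rw [hσ]
  exact Bowtie.limitSpectrum_subset_Icc Ω D₁ D₂
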